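/- **Definitions.** Let $M$ be a monoid. Say that $x$ is a left divisor of $y$ (and $y$ a right multiple of $x$) if $xz=y$ for some $z$, and a right divisor of $y$ if $zx=y$ for some $z$; right lcm's and left gcd's (resp. left lcm's and right gcd's) are taken with respect to left (resp. right) divisibility. An atom is an element $x\neq 1$ such that $x=yz$ implies $y=1$ or $z=1$; $M$ is atomic if it is generated by its atoms and, for each $x\in M$, the lengths of the decompositions of $x$ as a product of atoms are bounded. $M$ is Gaussian if it is atomic, cancellative, and any two elements have a right lcm, a left lcm, a right gcd and a left gcd. $M$ is a *Garside monoid* if it is Gaussian and contains an element $\Delta$ whose left divisors coincide with its right divisors, are finite in number, and generate $M$. When they are uniquely determined, $x\vee y$ denotes the right lcm and $x\backslash y$ the element with $x\vee y=x(x\backslash y)$. Let $\Sigma$ be a non-empty set, $\Sigma^*$ the set of words on $\Sigma$, $\varepsilon$ the empty word. A *reversing function* on $\Sigma$ is a partial map $f$ from $\Sigma\times\Sigma$ to $\Sigma^*$ with symmetric domain and with $f(a,a)=\varepsilon$ for all $a$; $R_f$ is the family of relations $af(a,b)=bf(b,a)$ for $(a,b)\in\mathrm{Dom}(f)$, and $\langle\Sigma;R_f\rangle^+$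 is the monoid it presents. If $\Sigma$ is a generating family of $M$ (that is, a map $\Sigma\to M$ whose image generates $M$), a partial map $f$ from $\Sigma\times\Sigma$ to $\Sigma^*$ is an *lcm selector* on $\Sigma$ if $f(a,b)$ is defined exactly when $a,b$ have a right lcm in $M$, and is then an expression of $a\backslash b$. A word on $\Sigma\cup\Sigma^{-1}$ is $f$-reversed by repeatedly replacing a factor $a^{-1}b$ ($a,b\in\Sigma$, $(a,b)\in \mathrm{Dom}(f)$) with $f(a,b)f(b,a)^{-1}$. For $u,v\in\Sigma^*$, $u\backslash_f v$ is the (unique) word $w\in\Sigma^*$ such that $u^{-1}v$ is reversed in finitely many steps to $ww'^{-1}$ for some $w'\in\Sigma^*$, if it exists (otherwise it is undefined, written $\bot$, and any expression containing $\bot$ is $\bot$), and $u\vee_f v=u(u\backslash_f v)$. Write $u\equiv_f^{++}v$ if $u\backslash_f v=v\backslash_f u=\varepsilon$; moreover $\bot\equiv_f^{++}\bot$ holds, while $\bot$ is equivalent to no word. The function $f$ has the *cube property* on $X\subseteq\Sigma^*$ if $(u\backslash_f v)\backslash_f(u\backslash_f w)\equiv_f^{++}(v\backslash_f u)\backslash_f(v\backslash_f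 w)$ for all $u,v,w\in X$. For a reversing function $f$ on $\Sigma$, let $(**)$ be the conjunction of the following conditions: (i) the closure $\widetilde\Sigma$ of $\Sigma$ under $\backslash_f$ exists (that is, $u\backslash_f v$ is defined for all $u,v\in\widetilde\Sigma$) and is finite; (ii) $f$ has the cube property on $\widetilde\Sigma$; (iii) denoting by $\widetilde\Sigma^{\vee}$ the closure of $\widetilde\Sigma$ under $\vee_f$, there is a word $\Omega\in\widetilde\Sigma^{\vee}$ such that, for every $u\in\widetilde\Sigma^{\vee}$, one has $\Omega\backslash_f u=\varepsilon$ and there is $v\in\widetilde\Sigma^{\vee}$ with $v\backslash_f\Omega\equiv_f^{++}u$. **Theorem.** Let $\Sigma$ be a non-empty set. (1) If $M$ is a Garside monoid, $\Sigma$ is a finite generating family of $M$ not containing $1$, and $f$ is an lcm selector on $\Sigma$, then $f$ is a reversing function on $\Sigma$, it satisfies $(**)$, and $M$ admits the presentation $\langle\Sigma;R_f\rangle^+$, i.e. the given map $\Sigma\to M$ induces an isomorphism $\langle\Sigma;R_f\rangle^+\cong M$. (2) Conversely, if $f$ is a reversing function on $\Sigma$ satisfying $(**)$, then $\langle\Sigma;R_f\rangle^+$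 is a Garside monoid and $f$ is an lcm selector on $\Sigma$ in it. (3) If $f$ is a reversing function on $\Sigma$ satisfying (i) and (ii), then $\widetilde\Sigma^{\vee}$ exists (that is, $\vee_f$ is everywhere defined on it) and is finite. -/

import Mathlib

/-!
Divisibility, Gaussian and Garside monoids, word reversing associated with a complemented
presentation, lcm selectors, and the finite conditions on a reversing function.
-/

universe u v

namespace GarsideReversing

section Monoids

variable {M : Type v} [Monoid M]

/-- `x` is a left divisor of `y` (equivalently, `y` is a right multiple of `x`). -/
def LeftDvd (x y : M) : Prop := ∃ z, x * z = y

/-- `x` is a right divisor of `y` (equivalently, `y` is a left multiple of `x`). -/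
def RightDvd (x y : M) : Prop := ∃ z, z * x = y

/-- `z` is a right lcm of `x` and `y`. -/
def IsRightLcm (x y z : M) : Prop :=
  LeftDvd x z ∧ LeftDvd y z ∧ ∀ t, LeftDvd x t → LeftDvd y t → LeftDvd z t

/-- `z` is a left lcm of `x` and `y`. -/
def IsLeftLcm (x y z : M) : Prop :=
  RightDvd x z ∧ RightDvd y z ∧ ∀ t, RightDvd x t → RightDvd y t → RightDvd z t

/-- `z` is a left gcd of `x` and `y`. -/
def IsLeftGcd (x y z : M) : Prop :=
  LeftDvd z x ∧ LeftDvd z y ∧ ∀ t, LeftDvd t x → LeftDvd t y → LeftDvd t z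

/-- `z` is a right gcd of `x` and `y`. -/
def IsRightGcd (x y z : M) : Prop :=
  RightDvd z x ∧ RightDvd z y ∧ ∀ t, RightDvd t x → RightDvd t y → RightDvd t z

/-- `z` is the right complement `x \ y`: the element with `x * z` the right lcm of `x` and `y`. -/
def IsRightComplement (x y z : M) : Prop := IsRightLcm x y (x * z)

/-- Atoms: elements `x ≠ 1` such that `x = y * z` implies `y = 1` or `z = 1`. -/
def IsAtomElt (x : M) : Prop := x ≠ 1 ∧ ∀ y z, x = y * z → y = 1 ∨ z = 1

variable (M) in
/-- `M` is generated by its atoms, and for every `x` the lengths of the decompositions of `x` as a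
product of atoms are bounded. -/
structure IsAtomicMonoid : Prop where
  generated : Submonoid.closure {x : M | IsAtomElt x} = ⊤
  norm_finite : ∀ x : M, ∃ N : ℕ, ∀ l : List M,
    (∀ a ∈ l, IsAtomElt a) → l.prod = x → l.length ≤ N

variable (M) in
/-- Gaussian monoids. -/
structure IsGaussian : Prop where
  atomic : IsAtomicMonoid M
  cancel : IsCancelMul M
  right_lcm : ∀ x y : M, ∃ z, IsRightLcm x y z
  left_lcm : ∀ x y : M, ∃ z, IsLeftLcm x y z
  right_gcd : ∀ x y : M, ∃ z, IsRightGcd x y z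
  left_gcd : ∀ x y : M, ∃ z, IsLeftGcd x y z

/-- Garside elements: the left and the right divisors coincide, are finitely many, and
generate. -/
structure IsGarsideElement (Δ : M) : Prop where
  divisors_eq : {x : M | LeftDvd x Δ} = {x : M | RightDvd x Δ}
  finite : {x : M | LeftDvd x Δ}.Finite
  generate : Submonoid.closure {x : M | LeftDvd x Δ} = ⊤

variable (M) in
/-- Garside monoids: Gaussian monoids that contain a Garside element. -/
structure IsGarside : Prop where
  gaussian : IsGaussian M
  exists_garside : ∃ Δ : M, IsGarsideElement Δ

end Monoids

section Reversing

variable {A : Type u}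

/-- A partial function `f` from `A × A` to words is an lcm selector on the generating family
`ι : A → M`: `f a b` is defined exactly when `ι a` and `ι b` have a right lcm, and it is then an
expression of the right complement of `ι a` and `ι b`. -/
structure IsLcmSelector {M : Type v} [Monoid M] (ι : A → M)
    (f : A → A → Option (FreeMonoid A)) : Prop where
  generates : Submonoid.closure (Set.range ι) = ⊤
  defined_iff : ∀ a b, (∃ w, f a b = some w) ↔ ∃ z, IsRightLcm (ι a) (ι b) z
  complement : ∀ a b w, f a b = some w → IsRightComplement (ι a) (ι b) (FreeMonoid.lift ι w)

/-- Reversing functions: partial functions `f` from `A × A` to words with symmetric domain and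
`f a a` equal to the empty word. -/
structure IsReversingFunction (f : A → A → Option (FreeMonoid A)) : Prop where
  self : ∀ a, f a a = some 1
  symm : ∀ a b, (∃ w, f a b = some w) → ∃ w, f b a = some w

/-- The relations `a f(a,b) = b f(b,a)`. -/
def rels (f : A → A → Option (FreeMonoid A)) (u v : FreeMonoid A) : Prop :=
  ∃ a b w w', f a b = some w ∧ f b a = some w' ∧
    u = FreeMonoid.of a * w ∧ v = FreeMonoid.of b * w'

/-- A word on `A` as a word on `A ∪ A⁻¹`; `Sum.inl a` is the letter `a`, `Sum.inr a` the letter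
`a⁻¹`. -/
def pos (w : FreeMonoid A) : FreeMonoid (A ⊕ A) := FreeMonoid.map Sum.inl w

/-- The formal inverse `w⁻¹` of a word `w` on `A`, as a word on `A ∪ A⁻¹`. -/
def neg (w : FreeMonoid A) : FreeMonoid (A ⊕ A) := FreeMonoid.map Sum.inr w.reverse

/-- One step of reversing: a factor `a⁻¹ b` is replaced with `f(a,b) f(b,a)⁻¹`. -/
inductive RevStep (f : A → A → Option (FreeMonoid A)) :
    FreeMonoid (A ⊕ A) → FreeMonoid (A ⊕ A) → Prop
  | intro (x y : FreeMonoid (A ⊕ A)) (a b : A) (w w' : FreeMonoid A)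
      (h : f a b = some w) (h' : f b a = some w') :
      RevStep f (x * FreeMonoid.of (Sum.inr a) * FreeMonoid.of (Sum.inl b) * y)
        (x * pos w * neg w' * y)

/-- Reversing: finitely many reversing steps. -/
def Reverses (f : A → A → Option (FreeMonoid A)) :
    FreeMonoid (A ⊕ A) → FreeMonoid (A ⊕ A) → Prop :=
  Relation.ReflTransGen (RevStep f)

open Classical in
/-- The partial operation `u \_f v` on words: the (unique) word `w` such that `u⁻¹ v` reverses to
`w w'⁻¹` for some word `w'`, and `none` if there is no such word. -/
noncomputable def under (f : A → A → Option (FreeMonoid A)) (u v : FreeMonoid A) :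
    Option (FreeMonoid A) :=
  if h : ∃ w, ∃ w', Reverses f (neg u * pos v) (pos w * neg w') then some h.choose else none

/-- The operation `\_f` on words extended by an undefined value `none`. -/
noncomputable def underBot (f : A → A → Option (FreeMonoid A)) (u v : Option (FreeMonoid A)) :
    Option (FreeMonoid A) :=
  u.bind fun u' => v.bind fun v' => under f u' v'

/-- The partial operation `u ∨_f v = u (u \_f v)` on words. -/
noncomputable def join (f : A → A → Option (FreeMonoid A)) (u v : FreeMonoid A) :
    Option (FreeMonoid A) :=
  (under f u v).map fun w => u * w

/-- The relation `u ≡⁺⁺ v`: both `u \_f v` and `v \_f u` are the empty word; the undefined value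
is related to itself only. -/
def EquivPP (f : A → A → Option (FreeMonoid A)) :
    Option (FreeMonoid A) → Option (FreeMonoid A) → Prop
  | some u, some v => under f u v = some 1 ∧ under f v u = some 1
  | none, none => True
  | _, _ => False

/-- The cube property of `f` on a set `X` of words. -/
def CubeOn (f : A → A → Option (FreeMonoid A)) (X : Set (FreeMonoid A)) : Prop :=
  ∀ u ∈ X, ∀ v ∈ X, ∀ w ∈ X,
    EquivPP f (underBot f (under f u v) (under f u w)) (underBot f (under f v u) (under f v w))

/-- The smallest set of words that contains `X` and is stable under a partial operation `op`
wherever `op` is defined. -/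
inductive OpClosure (op : FreeMonoid A → FreeMonoid A → Option (FreeMonoid A))
    (X : Set (FreeMonoid A)) : FreeMonoid A → Prop
  | base (u : FreeMonoid A) (hu : u ∈ X) : OpClosure op X u
  | step (u v w : FreeMonoid A) (hu : OpClosure op X u) (hv : OpClosure op X v)
      (hw : op u v = some w) : OpClosure op X w

/-- The operation `op` is defined on all pairs of elements of `X`. -/
def DefinedOn (op : FreeMonoid A → FreeMonoid A → Option (FreeMonoid A))
    (X : Set (FreeMonoid A)) : Prop :=
  ∀ u ∈ X, ∀ v ∈ X, ∃ w, op u v = some w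

/-- The closure of the alphabet (as a set of one-letter words) under `\_f`. -/
def underClosure (f : A → A → Option (FreeMonoid A)) : Set (FreeMonoid A) :=
  {w | OpClosure (under f) (Set.range FreeMonoid.of) w}

/-- The closure under `∨_f` of the closure of the alphabet under `\_f`. -/
def joinClosure (f : A → A → Option (FreeMonoid A)) : Set (FreeMonoid A) :=
  {w | OpClosure (join f) (underClosure f) w}

/-- The closure of the alphabet under `\_f` exists, that is, `\_f` is defined
everywhere on it, and it is finite. -/
def FiniteClosure (f : A → A → Option (FreeMonoid A)) : Prop :=
  DefinedOn (under f) (underClosure f) ∧ (underClosure f).Finite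

/-- There is a word `Ω` in the `∨_f`-closure such that, for every `u` in that closure, `Ω \_f u` is
empty and `u` is `≡⁺⁺`-equivalent to `v \_f Ω` for some `v` in that closure. -/
def OmegaCondition (f : A → A → Option (FreeMonoid A)) : Prop :=
  ∃ Ω ∈ joinClosure f, ∀ u ∈ joinClosure f,
    under f Ω u = some 1 ∧ ∃ v ∈ joinClosure f, EquivPP f (under f v Ω) (some u)

/-- The conjunction `(**)` of the three conditions. -/
structure StarStar (f : A → A → Option (FreeMonoid A)) : Prop where
  finite_closure : FiniteClosure f
  cube : CubeOn f (underClosure f)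
  omega : OmegaCondition f

end Reversing

end GarsideReversing

open GarsideReversing

/-!
Reversing computes right lcm's. Call a surjection `π : Σ* → M` onto a left cancellative monoid with
right lcm's and no nontrivial unit a reversing model when `u \_f v` always exists, `π` carries it to
the complement `π u \ π v`, and only the empty word represents `1`. Everything the theorem claims
about words can then be read off in `M`; for instance `u ≡⁺⁺ v` means `π u = π v`, and the cube
property expresses that the lcm of three elements can be computed in any order.

For (2) and (3), the cube property propagates from `Σ̃` to all words. Hence `≡⁺⁺` is a congruence,
it is the one generated by `R_f`, and `Σ* → ⟨Σ; R_f⟩⁺` is a reversing model. An element represented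
in the join closure of `Σ̃` is the lcm of its divisors represented in `Σ̃`, so there are finitely
many such elements; each word of the closure is a product of words of `Σ̃` whose partial products
represent a chain of these elements, which bounds the number of factors. The word `Ω` represents an
element `Δ` for which `s ↦ s \ Δ` permutes a finite generating set, so some power of `Δ` is central.
Every element divides a central one, which gives right cancellation, left lcm's and gcd's. For (1),
reversing `u⁻¹ v` terminates because every step takes place below a common right multiple of `u` and
`v`, where the length of decompositions is bounded, so `Σ* → M` is a reversing model as well.
-/

namespace GarsideReversing

section Words

variable {A : Type u} {f : A → A → Option (FreeMonoid A)}

theorem pos_one : pos (1 : FreeMonoid A) = 1 := rfl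

theorem neg_one : neg (1 : FreeMonoid A) = 1 := rfl

theorem neg_mul (u v : FreeMonoid A) : neg (u * v) = neg v * neg u := by
  simp only [neg, FreeMonoid.reverse_mul, map_mul]

theorem toList_pos (w : FreeMonoid A) : (pos w).toList = w.toList.map Sum.inl := rfl

theorem toList_neg (w : FreeMonoid A) : (neg w).toList = w.toList.reverse.map Sum.inr := rfl

/-- The formal inverse of a signed word. Reversing commutes with it, which exchanges the roles of
`u` and `v` in `u⁻¹ v`. -/
def formalInv (s : FreeMonoid (A ⊕ A)) : FreeMonoid (A ⊕ A) := FreeMonoid.map Sum.swap s.reverse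

theorem formalInv_mul (s t : FreeMonoid (A ⊕ A)) :
    formalInv (s * t) = formalInv t * formalInv s := by
  simp only [formalInv, FreeMonoid.reverse_mul, map_mul]

theorem formalInv_of (c : A ⊕ A) : formalInv (FreeMonoid.of c) = FreeMonoid.of c.swap := rfl

theorem formalInv_pos (w : FreeMonoid A) : formalInv (pos w) = neg w := by
  apply FreeMonoid.toList.injective
  change ((w.toList.map Sum.inl).reverse).map Sum.swap = w.toList.reverse.map Sum.inr
  rw [← List.map_reverse, List.map_map]
  rfl

theorem formalInv_neg (w : FreeMonoid A) : formalInv (neg w) = pos w := by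
  apply FreeMonoid.toList.injective
  change ((w.toList.reverse.map Sum.inr).reverse).map Sum.swap = w.toList.map Sum.inl
  rw [← List.map_reverse, List.map_map, List.reverse_reverse]
  rfl

theorem pos_mul_neg_inj {w w' z z' : FreeMonoid A} :
    pos w * neg w' = pos z * neg z' ↔ w = z ∧ w' = z' := by
  refine ⟨fun h => ?_, by rintro ⟨rfl, rfl⟩; rfl⟩
  have hlist : w.toList.map Sum.inl ++ w'.toList.reverse.map Sum.inr =
      z.toList.map Sum.inl ++ z'.toList.reverse.map (Sum.inr : A → A ⊕ A) :=
    congrArg FreeMonoid.toList h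
  have hpos := congrArg (List.filterMap Sum.getLeft?) hlist
  have hneg := congrArg (List.filterMap Sum.getRight?) hlist
  exact ⟨by simpa [List.filterMap_map, Function.comp_def] using hpos,
    by simpa [List.filterMap_map, Function.comp_def] using hneg⟩

theorem pos_mul_neg_ne (w w' : FreeMonoid A) (x y : FreeMonoid (A ⊕ A)) (a b : A) :
    pos w * neg w' ≠ x * FreeMonoid.of (Sum.inr a) * FreeMonoid.of (Sum.inl b) * y := by
  intro h
  have hsorted : (pos w * neg w').toList.Pairwise (fun c d => c.isLeft ∨ d.isRight) := by
    simp only [FreeMonoid.toList_mul, toList_pos, toList_neg, List.pairwise_append,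
      List.pairwise_map]
    exact ⟨List.pairwise_of_forall (by simp), List.pairwise_of_forall (by simp), by simp⟩
  rw [h] at hsorted
  simp [List.pairwise_append] at hsorted

theorem factor_at_start_eq_or_disjoint {m y y' : FreeMonoid (A ⊕ A)} {a b a' b' : A}
    (h : FreeMonoid.of (Sum.inr a) * FreeMonoid.of (Sum.inl b) * y =
      m * FreeMonoid.of (Sum.inr a') * FreeMonoid.of (Sum.inl b') * y') :
    (m = 1 ∧ a = a' ∧ b = b' ∧ y = y') ∨
      ∃ m', m = FreeMonoid.of (Sum.inr a) * FreeMonoid.of (Sum.inl b) * m' ∧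
        y = m' * FreeMonoid.of (Sum.inr a') * FreeMonoid.of (Sum.inl b') * y' := by
  rw [← FreeMonoid.toList.injective.eq_iff] at h
  simp only [FreeMonoid.toList_mul, FreeMonoid.toList_of] at h
  rcases hm : m.toList with _ | ⟨c, _ | ⟨d, m'⟩⟩ <;>
    simp only [hm, List.nil_append, List.cons_append, List.append_assoc, List.cons.injEq,
      Sum.inr.injEq, Sum.inl.injEq, reduceCtorEq, false_and, and_false] at h
  · obtain ⟨rfl, rfl, hy⟩ := h
    exact .inl ⟨FreeMonoid.toList.injective hm, rfl, rfl, FreeMonoid.toList.injective hy⟩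
  · obtain ⟨rfl, rfl, hy⟩ := h
    refine .inr ⟨FreeMonoid.ofList m', FreeMonoid.toList.injective hm,
      FreeMonoid.toList.injective ?_⟩
    simp only [FreeMonoid.toList_mul, FreeMonoid.toList_of, FreeMonoid.toList_ofList,
      List.append_assoc, List.cons_append, List.nil_append, hy]

theorem factor_eq_or_disjoint {x y x' y' : FreeMonoid (A ⊕ A)} {a b a' b' : A}
    (h : x * FreeMonoid.of (Sum.inr a) * FreeMonoid.of (Sum.inl b) * y =
      x' * FreeMonoid.of (Sum.inr a') * FreeMonoid.of (Sum.inl b') * y') :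
    (x = x' ∧ a = a' ∧ b = b' ∧ y = y') ∨
      (∃ m, x' = x * FreeMonoid.of (Sum.inr a) * FreeMonoid.of (Sum.inl b) * m ∧
        y = m * FreeMonoid.of (Sum.inr a') * FreeMonoid.of (Sum.inl b') * y') ∨
      ∃ m, x = x' * FreeMonoid.of (Sum.inr a') * FreeMonoid.of (Sum.inl b') * m ∧
        y' = m * FreeMonoid.of (Sum.inr a) * FreeMonoid.of (Sum.inl b) * y := by
  have hprefix : (∃ m, x' = x * m) ∨ ∃ m, x = x' * m := by
    simp only [mul_assoc] at h
    rcases List.append_eq_append_iff.1 (congrArg FreeMonoid.toList h) with ⟨m, hm, -⟩ | ⟨m, hm, -⟩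
    · exact .inl ⟨FreeMonoid.ofList m, hm⟩
    · exact .inr ⟨FreeMonoid.ofList m, hm⟩
  rcases hprefix with ⟨m, rfl⟩ | ⟨m, rfl⟩ <;> simp only [mul_assoc, mul_right_inj] at h ⊢
  · rcases factor_at_start_eq_or_disjoint (by simpa only [mul_assoc] using h) with
      ⟨rfl, rfl, rfl, rfl⟩ | ⟨m, rfl, rfl⟩
    · exact .inl ⟨(mul_one x).symm, rfl, rfl, rfl⟩
    · exact .inr (.inl ⟨m, by simp only [mul_assoc], by simp only [mul_assoc]⟩)
  · rcases factor_at_start_eq_or_disjoint (by simpa only [mul_assoc] using h.symm) with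
      ⟨rfl, rfl, rfl, rfl⟩ | ⟨m, rfl, rfl⟩
    · exact .inl ⟨mul_one x', rfl, rfl, rfl⟩
    · exact .inr (.inr ⟨m, by simp only [mul_assoc], by simp only [mul_assoc]⟩)

theorem RevStep.mul_mul {s t : FreeMonoid (A ⊕ A)} (h : RevStep f s t)
    (p q : FreeMonoid (A ⊕ A)) : RevStep f (p * s * q) (p * t * q) := by
  obtain ⟨x, y, a, b, w, w', hab, hba⟩ := h
  simpa only [mul_assoc] using RevStep.intro (p * x) (y * q) a b w w' hab hba

theorem RevStep.formalInv {s t : FreeMonoid (A ⊕ A)} (h : RevStep f s t) :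
    RevStep f (formalInv s) (formalInv t) := by
  obtain ⟨x, y, a, b, w, w', hab, hba⟩ := h
  simp only [formalInv_mul, formalInv_of, Sum.swap_inl, Sum.swap_inr, formalInv_pos,
    formalInv_neg]
  simpa only [mul_assoc] using
    RevStep.intro (GarsideReversing.formalInv y) (GarsideReversing.formalInv x) b a w' w hba hab

theorem not_revStep_pos_mul_neg (w w' : FreeMonoid A) (t : FreeMonoid (A ⊕ A)) :
    ¬ RevStep f (pos w * neg w') t := by
  generalize hs : pos w * neg w' = s
  rintro ⟨x, y, a, b⟩
  exact pos_mul_neg_ne w w' x y a b hs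

theorem exists_revStep_of_disjoint (x m y : FreeMonoid (A ⊕ A)) {a b a' b' : A}
    {w w' z z' : FreeMonoid A} (hab : f a b = some w) (hba : f b a = some w')
    (hab' : f a' b' = some z) (hba' : f b' a' = some z') :
    ∃ r,
      RevStep f (x * pos w * neg w' *
        (m * FreeMonoid.of (Sum.inr a') * FreeMonoid.of (Sum.inl b') * y)) r ∧
      RevStep f (x * FreeMonoid.of (Sum.inr a) * FreeMonoid.of (Sum.inl b) * m *
        pos z * neg z' * y) r := by
  refine ⟨x * pos w * neg w' * m * pos z * neg z' * y, ?_, ?_⟩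
  · simpa only [mul_assoc] using
      RevStep.intro (x * pos w * neg w' * m) y a' b' z z' hab' hba'
  · simpa only [mul_assoc] using
      RevStep.intro x (m * pos z * neg z' * y) a b w w' hab hba

theorem revStep_diamond {s t t' : FreeMonoid (A ⊕ A)} (h : RevStep f s t) (h' : RevStep f s t') :
    t = t' ∨ ∃ r, RevStep f t r ∧ RevStep f t' r := by
  generalize hs : s = s' at h'
  obtain ⟨x, y, a, b, w, w', hab, hba⟩ := h
  obtain ⟨x', y', a', b', z, z', hab', hba'⟩ := h'
  rcases factor_eq_or_disjoint hs with ⟨rfl, rfl, rfl, rfl⟩ | ⟨m, rfl, rfl⟩ | ⟨m, rfl, rfl⟩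
  · obtain rfl : w = z := Option.some.inj (hab.symm.trans hab')
    obtain rfl : w' = z' := Option.some.inj (hba.symm.trans hba')
    exact .inl rfl
  · exact .inr (exists_revStep_of_disjoint x m y' hab hba hab' hba')
  · obtain ⟨r, hr', hr⟩ := exists_revStep_of_disjoint x' m y hab' hba' hab hba
    exact .inr ⟨r, hr, hr'⟩

theorem revStep_neg_of_mul_pos_of {a b : A} {t : FreeMonoid (A ⊕ A)}
    (h : RevStep f (neg (FreeMonoid.of a) * pos (FreeMonoid.of b)) t) :
    ∃ w w', f a b = some w ∧ f b a = some w' := by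
  generalize hs : neg (FreeMonoid.of a) * pos (FreeMonoid.of b) = s at h
  obtain ⟨x, y, a', b', w, w', hab, hba⟩ := h
  have hlist : [Sum.inr a, Sum.inl b] =
      x.toList ++ [Sum.inr a'] ++ [Sum.inl b'] ++ y.toList := congrArg FreeMonoid.toList hs
  have hx : x.toList = [] := List.length_eq_zero_iff.1 (by
    have hlength := congrArg List.length hlist
    simp only [List.length_append, List.length_cons, List.length_nil] at hlength
    omega)
  simp only [hx, List.nil_append, List.cons_append, List.cons.injEq, Sum.inr.injEq,
    Sum.inl.injEq] at hlist
  obtain ⟨rfl, rfl, -⟩ := hlist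
  exact ⟨w, w', hab, hba⟩

theorem Reverses.mul_mul {s t : FreeMonoid (A ⊕ A)} (h : Reverses f s t)
    (p q : FreeMonoid (A ⊕ A)) : Reverses f (p * s * q) (p * t * q) :=
  Relation.ReflTransGen.lift (p * · * q) (fun _ _ hstep => hstep.mul_mul p q) _ _ h

theorem Reverses.formalInv {s t : FreeMonoid (A ⊕ A)} (h : Reverses f s t) :
    Reverses f (formalInv s) (formalInv t) :=
  Relation.ReflTransGen.lift _ (fun _ _ hstep => hstep.formalInv) _ _ h

theorem Reverses.join {s t t' : FreeMonoid (A ⊕ A)} (h : Reverses f s t) (h' : Reverses f s t') :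
    Relation.Join (Reverses f) t t' := by
  refine Relation.church_rosser (fun _ t t' ht ht' => ?_) h h'
  rcases revStep_diamond ht ht' with rfl | ⟨r, hr, hr'⟩
  · exact ⟨t, .refl, .refl⟩
  · exact ⟨r, .single hr, .single hr'⟩

theorem Reverses.eq_of_pos_mul_neg {w w' : FreeMonoid A} {t : FreeMonoid (A ⊕ A)}
    (h : Reverses f (pos w * neg w') t) : t = pos w * neg w' := by
  rcases h.cases_head with rfl | ⟨_, hstep, -⟩
  · rfl
  · exact (not_revStep_pos_mul_neg _ _ _ hstep).elim

/-- The word `u⁻¹ v` reverses to `w w'⁻¹`. Such a statement is read as a commutative square with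
sides `u`, `w` and `v`, `w'`; squares can be pasted along a common side. -/
def RevTo (f : A → A → Option (FreeMonoid A)) (u v w w' : FreeMonoid A) : Prop :=
  Reverses f (neg u * pos v) (pos w * neg w')

theorem RevTo.unique {u v w w' z z' : FreeMonoid A} (h : RevTo f u v w w')
    (h' : RevTo f u v z z') : w = z ∧ w' = z' := by
  obtain ⟨t, ht, ht'⟩ := Reverses.join h h'
  exact pos_mul_neg_inj.1 (ht.eq_of_pos_mul_neg.symm.trans ht'.eq_of_pos_mul_neg)

theorem RevTo.symm {u v w w' : FreeMonoid A} (h : RevTo f u v w w') : RevTo f v u w' w := by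
  simpa only [RevTo, formalInv_mul, formalInv_pos, formalInv_neg] using Reverses.formalInv h

theorem RevTo.one_left (v : FreeMonoid A) : RevTo f 1 v v 1 := by
  rw [RevTo, neg_one, one_mul, mul_one]
  exact .refl

theorem RevTo.one_right (u : FreeMonoid A) : RevTo f u 1 1 u := (RevTo.one_left u).symm

theorem RevTo.mul_left {u₁ u₂ v w z w' z' : FreeMonoid A} (h₁ : RevTo f u₁ v w w')
    (h₂ : RevTo f u₂ w z z') : RevTo f (u₁ * u₂) v z (w' * z') := by
  have hfirst := Reverses.mul_mul h₁ (neg u₂) 1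
  have hsecond := Reverses.mul_mul h₂ 1 (neg w')
  simp only [mul_assoc, one_mul, mul_one] at hfirst hsecond
  simpa only [RevTo, Reverses, neg_mul, mul_assoc] using hfirst.trans hsecond

theorem RevTo.mul_right {u v₁ v₂ w z w' z' : FreeMonoid A} (h₁ : RevTo f u v₁ w w')
    (h₂ : RevTo f w' v₂ z z') : RevTo f u (v₁ * v₂) (w * z) z' :=
  (RevTo.mul_left h₁.symm h₂.symm).symm

theorem RevTo.mul_mul {u₁ u₂ v₁ v₂ w w' p p' r r' q q' : FreeMonoid A}
    (h : RevTo f u₁ v₁ w w') (hleft : RevTo f u₂ w p p') (hright : RevTo f w' v₂ r r')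
    (hcorner : RevTo f p' r q q') : RevTo f (u₁ * u₂) (v₁ * v₂) (p * q) (r' * q') :=
  (h.mul_left hleft).mul_right (hright.mul_left hcorner)

theorem RevTo.of_of {a b : A} {w w' : FreeMonoid A} (h : f a b = some w) (h' : f b a = some w') :
    RevTo f (FreeMonoid.of a) (FreeMonoid.of b) w w' := by
  have hstep := RevStep.intro 1 1 a b w w' h h'
  simp only [one_mul, mul_one] at hstep
  exact .single hstep

theorem RevTo.eq_some_of_of {a b : A} {w w' : FreeMonoid A}
    (h : RevTo f (FreeMonoid.of a) (FreeMonoid.of b) w w') :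
    f a b = some w ∧ f b a = some w' := by
  rcases h.cases_head with heq | ⟨_, hstep, -⟩
  · exact (pos_mul_neg_ne w w' 1 1 a b heq.symm).elim
  · obtain ⟨z, z', hab, hba⟩ := revStep_neg_of_mul_pos_of hstep
    obtain ⟨rfl, rfl⟩ := h.unique (.of_of hab hba)
    exact ⟨hab, hba⟩

theorem RevTo.self (hself : ∀ a, f a a = some 1) (u : FreeMonoid A) : RevTo f u u 1 1 := by
  induction u using FreeMonoid.inductionOn' with
  | one => exact .one_left 1
  | of_mul a u ih =>
    have hletter : RevTo f (FreeMonoid.of a) (FreeMonoid.of a) 1 1 := .of_of (hself a) (hself a)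
    exact hletter.mul_mul (.one_right u) (.one_left u) ih

theorem under_eq_some {u v w : FreeMonoid A} : under f u v = some w ↔ ∃ w', RevTo f u v w w' := by
  unfold under
  split_ifs with hrev
  · obtain ⟨w₀', hchosen⟩ := hrev.choose_spec
    rw [Option.some.injEq]
    refine ⟨fun h => ⟨w₀', h ▸ hchosen⟩, ?_⟩
    rintro ⟨w', h⟩
    exact (RevTo.unique hchosen h).1
  · exact ⟨nofun, fun h => (hrev ⟨w, h⟩).elim⟩

end Words

section Soundness

variable {A : Type u} {f : A → A → Option (FreeMonoid A)} {M : Type v} [Monoid M]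

/-- The signed word labels a path from `x` to `y` in the Cayley graph of `M`. Since `M` need not be
a group, this is what it means for a reversing diagram to commute in `M`. -/
def IsPath (π : FreeMonoid A →* M) : List (A ⊕ A) → M → M → Prop
  | [], x, y => x = y
  | Sum.inl a :: s, x, y => IsPath π s (x * π (FreeMonoid.of a)) y
  | Sum.inr a :: s, x, y => ∃ z, x = z * π (FreeMonoid.of a) ∧ IsPath π s z y

theorem isPath_append (π : FreeMonoid A →* M) (s t : List (A ⊕ A)) (x y : M) :
    IsPath π (s ++ t) x y ↔ ∃ z, IsPath π s x z ∧ IsPath π t z y := by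
  induction s generalizing x with
  | nil => simp only [List.nil_append, IsPath, exists_eq_left']
  | cons c s ih =>
    rcases c with a | a
    · simp only [List.cons_append, IsPath, ih]
    · simp only [List.cons_append, IsPath, ih]
      constructor
      · rintro ⟨z, hz, r, hs, ht⟩
        exact ⟨r, ⟨z, hz, hs⟩, ht⟩
      · rintro ⟨r, ⟨z, hz, hs⟩, ht⟩
        exact ⟨z, hz, r, hs, ht⟩

theorem isPath_pos (π : FreeMonoid A →* M) (w : FreeMonoid A) (x y : M) :
    IsPath π (pos w).toList x y ↔ y = x * π w := by
  induction w using FreeMonoid.inductionOn' generalizing x with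
  | one => simp [pos_one, IsPath, eq_comm]
  | of_mul a w ih =>
    rw [map_mul, ← mul_assoc]
    exact ih _

theorem isPath_neg (π : FreeMonoid A →* M) (w : FreeMonoid A) (x y : M) :
    IsPath π (neg w).toList x y ↔ x = y * π w := by
  induction w using FreeMonoid.inductionOn' generalizing y with
  | one => simp [neg_one, IsPath]
  | of_mul a w ih =>
    have hletter (z : M) : IsPath π (neg (FreeMonoid.of a)).toList z y ↔
        z = y * π (FreeMonoid.of a) := by
      change (∃ r, z = r * _ ∧ r = y) ↔ _
      rw [exists_eq_right]
    simp only [neg_mul, FreeMonoid.toList_mul, isPath_append, hletter, ih, exists_eq_right,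
      map_mul, mul_assoc]

theorem RevStep.isPath {π : FreeMonoid A →* M} (hπ : ∀ u v, rels f u v → π u = π v)
    {s t : FreeMonoid (A ⊕ A)} (h : RevStep f s t) {x y : M} (hs : IsPath π s.toList x y) :
    IsPath π t.toList x y := by
  obtain ⟨p, q, a, b, w, w', hab, hba⟩ := h
  simp only [mul_assoc, FreeMonoid.toList_mul, FreeMonoid.toList_of, isPath_append,
    isPath_pos, isPath_neg] at hs ⊢
  obtain ⟨z₁, hp, z₂, ⟨z, rfl, rfl⟩, z₃, rfl, hq⟩ := hs
  refine ⟨_, hp, _, rfl, _, ?_, hq⟩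
  rw [mul_assoc, mul_assoc, ← map_mul, ← map_mul, hπ _ _ ⟨a, b, w, w', hab, hba, rfl, rfl⟩]

theorem Reverses.isPath {π : FreeMonoid A →* M} (hπ : ∀ u v, rels f u v → π u = π v)
    {s t : FreeMonoid (A ⊕ A)} (h : Reverses f s t) {x y : M} (hs : IsPath π s.toList x y) :
    IsPath π t.toList x y := by
  induction h with
  | refl => exact hs
  | tail _ hstep ih => exact hstep.isPath hπ ih

theorem RevTo.map_mul_eq {π : FreeMonoid A →* M} (hπ : ∀ u v, rels f u v → π u = π v)
    {u v w w' : FreeMonoid A} (h : RevTo f u v w w') : π u * π w = π v * π w' := by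
  have hsource : IsPath π (neg u * pos v).toList (π u) (π v) := by
    simp only [FreeMonoid.toList_mul, isPath_append, isPath_neg, isPath_pos]
    exact ⟨1, (one_mul _).symm, (one_mul _).symm⟩
  have htarget := Reverses.isPath hπ h hsource
  simp only [FreeMonoid.toList_mul, isPath_append, isPath_neg, isPath_pos] at htarget
  obtain ⟨z, hw, hw'⟩ := htarget
  exact hw.symm.trans hw'

end Soundness

section Complement

open scoped Pointwise

/-- The laws of the complement operation of a monoid where right lcm's exist, as far as they hold
already for words under `\_f`. -/
structure IsComplementOp {W : Type*} [Monoid W] (c : W → W → W) : Prop where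
  one_left : ∀ v, c 1 v = v
  one_right : ∀ v, c v 1 = 1
  self : ∀ v, c v v = 1
  mul_left : ∀ u v w, c (u * v) w = c v (c u w)
  mul_right : ∀ w u v, c w (u * v) = c w u * c (c u w) v

variable {W : Type*} [Monoid W] {c : W → W → W}

/-- The relation `u \ v = v \ u = 1`, the counterpart of `≡⁺⁺` for a total complement operation. -/
def ComplEquiv (c : W → W → W) (u v : W) : Prop := c u v = 1 ∧ c v u = 1

/-- The cube property at a triple of elements. -/
def CubeAt (c : W → W → W) (u v w : W) : Prop :=
  ComplEquiv c (c (c u v) (c u w)) (c (c v u) (c v w))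

theorem ComplEquiv.symm {u v : W} (h : ComplEquiv c u v) : ComplEquiv c v u := ⟨h.2, h.1⟩

theorem CubeAt.symm {u v w : W} (h : CubeAt c u v w) : CubeAt c v u w := ⟨h.2, h.1⟩

theorem exists_mem_pow_of_closure_eq_top {X : Set W} (hgen : Submonoid.closure X = ⊤) (u : W) :
    ∃ n : ℕ, u ∈ X ^ n := by
  induction u using Submonoid.dense_induction X hgen with
  | mem x hx => exact ⟨1, by rwa [pow_one]⟩
  | one => exact ⟨0, Set.mem_one.2 rfl⟩
  | mul x y hx hy =>
    obtain ⟨m, hm⟩ := hx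
    obtain ⟨n, hn⟩ := hy
    exact ⟨m + n, pow_add X m n ▸ Set.mul_mem_mul hm hn⟩

namespace IsComplementOp

variable (hc : IsComplementOp c)
include hc

theorem eq_one_of_complEquiv_one {u : W} (h : ComplEquiv c 1 u) : u = 1 :=
  (hc.one_left u).symm.trans h.1

theorem complEquiv_refl (u : W) : ComplEquiv c u u := ⟨hc.self u, hc.self u⟩

theorem complEquiv_mul {a b a' b' : W} (ha : ComplEquiv c a a') (hb : ComplEquiv c b b') :
    ComplEquiv c (a * b) (a' * b') := by
  constructor
  · rw [hc.mul_left, hc.mul_right, ha.1, ha.2, hc.one_left, one_mul, hb.1]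
  · rw [hc.mul_left, hc.mul_right, ha.1, ha.2, hc.one_left, one_mul, hb.2]

theorem mul_complEquiv_mul (u v : W) : ComplEquiv c (u * c u v) (v * c v u) := by
  constructor
  · rw [hc.mul_left, hc.mul_right, hc.self, mul_one, hc.self]
  · rw [hc.mul_left, hc.mul_right, hc.self, mul_one, hc.self]

theorem mul_left_mul (w u v : W) : c (w * u) (w * v) = c u v := by
  rw [hc.mul_left, hc.mul_right, hc.self, hc.one_left, one_mul]

theorem cubeAt_one_left (v w : W) : CubeAt c 1 v w := by
  rw [CubeAt, hc.one_left, hc.one_left, hc.one_right, hc.one_left]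
  exact hc.complEquiv_refl _

theorem cubeAt_one_right (u v : W) : CubeAt c u v 1 := by
  simp only [CubeAt, hc.one_right]
  exact hc.complEquiv_refl 1

theorem eq_one_of_cubeAt {u v w : W} (h : CubeAt c u v w) (huv : c u v = 1) (huw : c u w = 1) :
    c (c v u) (c v w) = 1 := by
  rw [CubeAt, huv, huw, hc.self] at h
  exact hc.eq_one_of_complEquiv_one h

theorem complEquiv_trans {u v w : W} (huvw : CubeAt c v u w) (hwvu : CubeAt c v w u)
    (huv : ComplEquiv c u v) (hvw : ComplEquiv c v w) : ComplEquiv c u w := by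
  constructor
  · simpa only [huv.1, hc.one_left] using hc.eq_one_of_cubeAt huvw huv.2 hvw.1
  · simpa only [hvw.2, hc.one_left] using hc.eq_one_of_cubeAt hwvu hvw.1 huv.2

theorem complEquiv_left {u v w : W} (h : CubeAt c u v w) (huv : ComplEquiv c u v) :
    ComplEquiv c (c u w) (c v w) := by
  rwa [CubeAt, huv.1, huv.2, hc.one_left, hc.one_left] at h

theorem complEquiv_right {u v w : W} (hu : CubeAt c u w v) (hv : CubeAt c v w u)
    (huv : ComplEquiv c u v) : ComplEquiv c (c w u) (c w v) := by
  rw [CubeAt, huv.1, hc.one_right] at hu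
  rw [CubeAt, huv.2, hc.one_right] at hv
  exact ⟨hc.eq_one_of_complEquiv_one hu, hc.eq_one_of_complEquiv_one hv⟩

section Extension

variable {X : Set W} (hX : ∀ u ∈ X, ∀ v ∈ X, c u v ∈ X) (hgen : Submonoid.closure X = ⊤)
include hX hgen

theorem compl_mem (u : W) {v : W} (hv : v ∈ X) : c u v ∈ X := by
  induction u using Submonoid.dense_induction X hgen generalizing v with
  | mem u hu => exact hX u hu v hv
  | one => rwa [hc.one_left]
  | mul x y hx hy => rw [hc.mul_left]; exact hy (hx hv)

theorem compl_mem_pow (u : W) {n : ℕ} {v : W} (hv : v ∈ X ^ n) : c u v ∈ X ^ n := by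
  induction n generalizing u v with
  | zero =>
    rw [pow_zero, Set.mem_one] at hv ⊢
    rw [hv, hc.one_right]
  | succ n ih =>
    rw [pow_succ] at hv ⊢
    obtain ⟨v₁, hv₁, v₂, hv₂, rfl⟩ := hv
    simp only [hc.mul_right]
    exact Set.mul_mem_mul (ih u hv₁) (hc.compl_mem hX hgen _ hv₂)

variable (hcube : ∀ u ∈ X, ∀ v ∈ X, ∀ w ∈ X, CubeAt c u v w)

omit hX hgen in
include hcube in
theorem complEquiv_trans_of_mem {u v w : W} (hu : u ∈ X) (hv : v ∈ X) (hw : w ∈ X)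
    (huv : ComplEquiv c u v) (hvw : ComplEquiv c v w) : ComplEquiv c u w :=
  hc.complEquiv_trans (hcube v hv u hu w hw) (hcube v hv w hw u hu) huv hvw

include hcube

theorem complEquiv_right_of_mem (u : W) {v w : W} (hv : v ∈ X) (hw : w ∈ X)
    (h : ComplEquiv c v w) : ComplEquiv c (c u v) (c u w) := by
  induction u using Submonoid.dense_induction X hgen generalizing v w with
  | mem u hu => exact hc.complEquiv_right (hcube v hv u hu w hw) (hcube w hw u hu v hv) h
  | one => rwa [hc.one_left, hc.one_left]
  | mul x y hx hy =>
    rw [hc.mul_left, hc.mul_left]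
    exact hy (hc.compl_mem hX hgen x hv) (hc.compl_mem hX hgen x hw) (hx hv hw h)

theorem cubeAt_mul_left {u₁ u₂ v w : W} (hw : w ∈ X) (h₁ : CubeAt c u₁ v w)
    (h₂ : CubeAt c u₂ (c u₁ v) (c u₁ w)) : CubeAt c (u₁ * u₂) v w := by
  have hmem (x y z : W) : c x (c y (c z w)) ∈ X :=
    hc.compl_mem hX hgen _ (hc.compl_mem hX hgen _ (hc.compl_mem hX hgen _ hw))
  rw [CubeAt, hc.mul_left, hc.mul_left, hc.mul_right, hc.mul_left]
  exact hc.complEquiv_trans_of_mem hcube (hmem _ _ _) (hmem _ _ _) (hmem _ _ _) h₂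
    (hc.complEquiv_right_of_mem hX hgen hcube _
      (hc.compl_mem hX hgen _ (hc.compl_mem hX hgen _ hw))
      (hc.compl_mem hX hgen _ (hc.compl_mem hX hgen _ hw)) h₁)

theorem cubeAt_of_mem_of_mem (u : W) {v w : W} (hv : v ∈ X) (hw : w ∈ X) : CubeAt c u v w := by
  induction u using Submonoid.dense_induction X hgen generalizing v w with
  | mem u hu => exact hcube u hu v hv w hw
  | one => exact hc.cubeAt_one_left v w
  | mul x y hx hy =>
    exact hc.cubeAt_mul_left hX hgen hcube hw (hx hv hw)
      (hy (hc.compl_mem hX hgen x hv) (hc.compl_mem hX hgen x hw))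

theorem cubeAt_of_mem (u v : W) {w : W} (hw : w ∈ X) : CubeAt c u v w := by
  induction u using Submonoid.dense_induction X hgen generalizing v w with
  | mem u hu => exact (hc.cubeAt_of_mem_of_mem hX hgen hcube v hu hw).symm
  | one => exact hc.cubeAt_one_left v w
  | mul x y hx hy =>
    exact hc.cubeAt_mul_left hX hgen hcube hw (hx v hw) (hy _ (hc.compl_mem hX hgen x hw))

theorem cubeAt_mul_right {u v w₁ w₂ : W} (hw₂ : w₂ ∈ X) (huvw : CubeAt c u v w₁)
    (huwv : CubeAt c u w₁ v) (hvwu : CubeAt c v w₁ u) : CubeAt c u v (w₁ * w₂) := by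
  have hmem (x y : W) : c x (c y w₂) ∈ X := hc.compl_mem hX hgen _ (hc.compl_mem hX hgen _ hw₂)
  have hcube_right (x y : W) {z : W} (hz : z ∈ X) : CubeAt c x y z :=
    hc.cubeAt_of_mem hX hgen hcube x y hz
  rw [CubeAt, hc.mul_right u, hc.mul_right v, hc.mul_right, hc.mul_right]
  refine hc.complEquiv_mul huvw ?_
  have hu : ComplEquiv c (c (c (c u w₁) (c u v)) (c (c w₁ u) w₂))
      (c (c (c w₁ u) (c w₁ v)) (c (c w₁ u) w₂)) :=
    hc.complEquiv_left (hcube_right _ _ (hc.compl_mem hX hgen _ hw₂)) huwv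
  have hv : ComplEquiv c (c (c (c v w₁) (c v u)) (c (c w₁ v) w₂))
      (c (c (c w₁ v) (c w₁ u)) (c (c w₁ v) w₂)) :=
    hc.complEquiv_left (hcube_right _ _ (hc.compl_mem hX hgen _ hw₂)) hvwu
  have hmiddle : CubeAt c (c w₁ u) (c w₁ v) w₂ := hcube_right _ _ hw₂
  have htrans {x y z : W} := hc.complEquiv_trans_of_mem hcube (u := x) (v := y) (w := z)
  exact htrans (hmem _ _) (hmem _ _) (hmem _ _)
    (htrans (hmem _ _) (hmem _ _) (hmem _ _) hu hmiddle) hv.symm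

/-- The induction is on the total length of the three words with respect to `X`, and only ever
splits the third one: the two permuted instances of the cube put each of the others in its place. -/
theorem cubeAt_of_mem_pow {i j k : ℕ} {u v w : W} (hu : u ∈ X ^ i) (hv : v ∈ X ^ j)
    (hw : w ∈ X ^ k) : CubeAt c u v w := by
  induction hn : i + j + k generalizing i j k u v w with
  | zero =>
    obtain rfl : k = 0 := by omega
    rw [pow_zero, Set.mem_one] at hw
    exact hw ▸ hc.cubeAt_one_right u v
  | succ n ih =>
    cases k with
    | zero =>
      rw [pow_zero, Set.mem_one] at hw
      exact hw ▸ hc.cubeAt_one_right u v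
    | succ k =>
      rw [pow_succ] at hw
      obtain ⟨w₁, hw₁, w₂, hw₂, rfl⟩ := hw
      exact hc.cubeAt_mul_right hX hgen hcube hw₂ (ih hu hv hw₁ (by omega))
        (ih hu hw₁ hv (by omega)) (ih hv hw₁ hu (by omega))

theorem cubeAt_of_closure_eq_top (u v w : W) : CubeAt c u v w := by
  obtain ⟨i, hu⟩ := exists_mem_pow_of_closure_eq_top hgen u
  obtain ⟨j, hv⟩ := exists_mem_pow_of_closure_eq_top hgen v
  obtain ⟨k, hw⟩ := exists_mem_pow_of_closure_eq_top hgen w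
  exact hc.cubeAt_of_mem_pow hX hgen hcube hu hv hw

end Extension

end IsComplementOp

end Complement

section LcmMonoid

variable {M : Type*} [Monoid M]

theorem LeftDvd.refl (x : M) : LeftDvd x x := ⟨1, mul_one x⟩

theorem LeftDvd.trans {x y z : M} (hxy : LeftDvd x y) (hyz : LeftDvd y z) : LeftDvd x z := by
  obtain ⟨a, rfl⟩ := hxy
  obtain ⟨b, rfl⟩ := hyz
  exact ⟨a * b, (mul_assoc _ _ _).symm⟩

theorem leftDvd_mul (x y : M) : LeftDvd x (x * y) := ⟨y, rfl⟩

theorem one_leftDvd (x : M) : LeftDvd 1 x := ⟨x, one_mul x⟩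

theorem LeftDvd.mul_left {x y : M} (h : LeftDvd x y) (z : M) : LeftDvd (z * x) (z * y) := by
  obtain ⟨a, rfl⟩ := h
  exact ⟨a, mul_assoc _ _ _⟩

theorem leftDvd_of_mul_leftDvd_mul [IsLeftCancelMul M] {x y z : M}
    (h : LeftDvd (x * y) (x * z)) : LeftDvd y z := by
  obtain ⟨a, ha⟩ := h
  exact ⟨a, mul_left_cancel ((mul_assoc x y a).symm.trans ha)⟩

theorem IsRightLcm.symm {x y z : M} (h : IsRightLcm x y z) : IsRightLcm y x z :=
  ⟨h.2.1, h.1, fun t hy hx => h.2.2 t hx hy⟩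

theorem isRightLcm_of_leftDvd {x y : M} (h : LeftDvd y x) : IsRightLcm x y x :=
  ⟨.refl x, h, fun _ hx _ => hx⟩

/-- Left cancellative monoids without nontrivial units where any two elements have a right lcm.
These are the monoids in which the right complement `x \ y` is a total, uniquely determined
operation. -/
class IsLcmMonoid (M : Type*) [Monoid M] : Prop extends IsLeftCancelMul M where
  conical : ∀ {x y : M}, x * y = 1 → y = 1
  exists_isRightComplement : ∀ x y : M, ∃ z, IsRightComplement x y z

variable [IsLcmMonoid M]

/-- The right complement `x \ y` in an lcm monoid. -/
noncomputable def rightCompl (x y : M) : M :=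
  (IsLcmMonoid.exists_isRightComplement x y).choose

theorem LeftDvd.antisymm {x y : M} (hxy : LeftDvd x y) (hyx : LeftDvd y x) : x = y := by
  obtain ⟨a, rfl⟩ := hxy
  obtain ⟨b, hb⟩ := hyx
  have hab : a * b = 1 := mul_left_cancel (a := x) (by rw [← mul_assoc, hb, mul_one])
  rw [IsLcmMonoid.conical (mul_eq_one_symm hab), mul_one]

theorem IsRightLcm.unique {x y z z' : M} (hz : IsRightLcm x y z) (hz' : IsRightLcm x y z') :
    z = z' :=
  (hz.2.2 z' hz'.1 hz'.2.1).antisymm (hz'.2.2 z hz.1 hz.2.1)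

theorem isRightLcm_rightCompl (x y : M) : IsRightLcm x y (x * rightCompl x y) :=
  (IsLcmMonoid.exists_isRightComplement x y).choose_spec

theorem rightCompl_eq {x y z : M} (h : IsRightComplement x y z) : rightCompl x y = z :=
  mul_left_cancel ((isRightLcm_rightCompl x y).unique h)

theorem mul_rightCompl_comm (x y : M) : x * rightCompl x y = y * rightCompl y x :=
  (isRightLcm_rightCompl x y).unique (isRightLcm_rightCompl y x).symm

theorem mul_rightCompl_of_leftDvd {x y : M} (h : LeftDvd x y) : x * rightCompl x y = y :=
  (isRightLcm_rightCompl x y).unique (isRightLcm_of_leftDvd h).symm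

theorem rightCompl_mul (x y : M) : rightCompl x (x * y) = y :=
  mul_left_cancel (mul_rightCompl_of_leftDvd (leftDvd_mul x y))

theorem rightCompl_eq_one_iff {x y : M} : rightCompl y x = 1 ↔ LeftDvd x y := by
  refine ⟨fun h => ?_, fun h => rightCompl_eq ?_⟩
  · simpa only [h, mul_one] using (isRightLcm_rightCompl y x).2.1
  · simpa only [IsRightComplement, mul_one] using isRightLcm_of_leftDvd h

theorem rightCompl_mul_left (u v w : M) :
    rightCompl (u * v) w = rightCompl v (rightCompl u w) := by
  have hinner := isRightLcm_rightCompl u w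
  have houter := isRightLcm_rightCompl v (rightCompl u w)
  apply rightCompl_eq
  refine ⟨leftDvd_mul _ _, ?_, ?_⟩
  · rw [mul_assoc]
    exact hinner.2.1.trans (houter.2.1.mul_left u)
  · rintro _ ⟨s, rfl⟩ hw
    rw [mul_assoc] at hw ⊢
    rw [mul_assoc]
    exact (houter.2.2 _ (leftDvd_mul v s)
      (leftDvd_of_mul_leftDvd_mul (hinner.2.2 _ (leftDvd_mul u _) hw))).mul_left u

theorem rightCompl_mul_right (w u v : M) :
    rightCompl w (u * v) = rightCompl w u * rightCompl (rightCompl u w) v := by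
  apply mul_left_cancel (a := w)
  rw [mul_rightCompl_comm, rightCompl_mul_left, mul_assoc, ← mul_rightCompl_comm _ v, ← mul_assoc,
    mul_rightCompl_comm u w, mul_assoc]

theorem isComplementOp_rightCompl : IsComplementOp (rightCompl : M → M → M) where
  one_left v := by simpa only [one_mul] using rightCompl_mul 1 v
  one_right v := rightCompl_eq_one_iff.2 (one_leftDvd v)
  self v := rightCompl_eq_one_iff.2 (.refl v)
  mul_left := rightCompl_mul_left
  mul_right := rightCompl_mul_right

theorem LeftDvd.rightCompl {y z : M} (h : LeftDvd y z) (x : M) :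
    LeftDvd (rightCompl x y) (rightCompl x z) :=
  leftDvd_of_mul_leftDvd_mul ((isRightLcm_rightCompl x y).2.2 _ (leftDvd_mul _ _)
    (h.trans (isRightLcm_rightCompl x z).2.1))

theorem IsRightLcm.rightCompl {y z m : M} (h : IsRightLcm y z m) (x : M) :
    IsRightLcm (rightCompl x y) (rightCompl x z) (rightCompl x m) := by
  refine ⟨h.1.rightCompl x, h.2.1.rightCompl x, fun t hy hz => ?_⟩
  apply leftDvd_of_mul_leftDvd_mul (x := x)
  refine (isRightLcm_rightCompl x m).2.2 _ (leftDvd_mul _ _) (h.2.2 _ ?_ ?_)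
  · exact (isRightLcm_rightCompl x y).2.1.trans (hy.mul_left x)
  · exact (isRightLcm_rightCompl x z).2.1.trans (hz.mul_left x)

end LcmMonoid

section Norm

variable {M : Type*} [Monoid M]

/-- A norm on a monoid: it strictly decreases when passing to proper factors. The existence of one
is equivalent to atomicity. -/
structure IsStrictNorm (ν : M → ℕ) : Prop where
  lt_mul_left : ∀ {x : M}, x ≠ 1 → ∀ y, ν y < ν (x * y)
  lt_mul_right : ∀ {y : M}, y ≠ 1 → ∀ x, ν x < ν (x * y)

/-- The lengths of the decompositions of `x` as a product of atoms; their maximum is the standard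
norm of an atomic monoid. -/
def atomLengths (x : M) : Set ℕ :=
  {n | ∃ l : List M, (∀ a ∈ l, IsAtomElt a) ∧ l.prod = x ∧ l.length = n}

theorem add_mem_atomLengths_mul {x y : M} {m n : ℕ} (hm : m ∈ atomLengths x)
    (hn : n ∈ atomLengths y) : m + n ∈ atomLengths (x * y) := by
  obtain ⟨l, hl, rfl, rfl⟩ := hm
  obtain ⟨l', hl', rfl, rfl⟩ := hn
  exact ⟨l ++ l', List.forall_mem_append.2 ⟨hl, hl'⟩, List.prod_append, List.length_append⟩

theorem pos_of_mem_atomLengths {x : M} (hx : x ≠ 1) {n : ℕ} (hn : n ∈ atomLengths x) : 0 < n := by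
  obtain ⟨l, -, rfl, rfl⟩ := hn
  refine List.length_pos_iff.2 ?_
  rintro rfl
  exact hx List.prod_nil

theorem IsAtomicMonoid.atomLengths_nonempty (h : IsAtomicMonoid M) (x : M) :
    (atomLengths x).Nonempty := by
  obtain ⟨l, hl, hx⟩ := Submonoid.exists_list_of_mem_closure (h.generated ▸ Submonoid.mem_top x)
  exact ⟨l.length, l, hl, hx, rfl⟩

theorem IsAtomicMonoid.bddAbove_atomLengths (h : IsAtomicMonoid M) (x : M) :
    BddAbove (atomLengths x) := by
  obtain ⟨N, hN⟩ := h.norm_finite x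
  refine ⟨N, ?_⟩
  rintro _ ⟨l, hl, hx, rfl⟩
  exact hN l hl hx

theorem IsAtomicMonoid.exists_isStrictNorm (h : IsAtomicMonoid M) :
    ∃ ν : M → ℕ, IsStrictNorm ν := by
  have hmax (x : M) := Nat.sSup_mem (h.atomLengths_nonempty x) (h.bddAbove_atomLengths x)
  have hadd (x y : M) : sSup (atomLengths x) + sSup (atomLengths y) ≤ sSup (atomLengths (x * y)) :=
    le_csSup (h.bddAbove_atomLengths _) (add_mem_atomLengths_mul (hmax x) (hmax y))
  refine ⟨fun x => sSup (atomLengths x), fun {x} hx y => ?_, fun {y} hy x => ?_⟩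
  · exact (Nat.lt_add_of_pos_left (pos_of_mem_atomLengths hx (hmax x))).trans_le (hadd x y)
  · exact (Nat.lt_add_of_pos_right (pos_of_mem_atomLengths hy (hmax y))).trans_le (hadd x y)

namespace IsStrictNorm

variable {ν : M → ℕ} (hν : IsStrictNorm ν)
include hν

theorem le_mul_right (x y : M) : ν x ≤ ν (x * y) := by
  rcases eq_or_ne y 1 with rfl | hy
  · rw [mul_one]
  · exact (hν.lt_mul_right hy x).le

theorem eq_one_of_mul_eq_one {x y : M} (h : x * y = 1) : y = 1 := by
  by_contra hy
  have hx : x ≠ 1 := by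
    rintro rfl
    exact hy (by rwa [one_mul] at h)
  have hlt : ν y < ν 1 := h ▸ hν.lt_mul_left hx y
  have hlt' : ν 1 < ν y := by simpa only [one_mul] using hν.lt_mul_right hy 1
  exact hlt.asymm hlt'

theorem closure_atoms_eq_top : Submonoid.closure {x : M | IsAtomElt x} = ⊤ := by
  refine (Submonoid.eq_top_iff' _).2 fun x => ?_
  induction hn : ν x using Nat.strong_induction_on generalizing x with
  | _ n ih =>
    subst hn
    by_cases hatom : IsAtomElt x
    · exact Submonoid.subset_closure hatom
    by_cases hx : x = 1
    · exact hx ▸ one_mem _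
    simp only [IsAtomElt, not_and, not_forall, not_or] at hatom
    obtain ⟨y, z, rfl, hy, hz⟩ := hatom hx
    exact mul_mem (ih _ (hν.lt_mul_right hz y) y rfl) (ih _ (hν.lt_mul_left hy z) z rfl)

theorem length_le_prod {l : List M} (hl : ∀ x ∈ l, x ≠ 1) : l.length ≤ ν l.prod := by
  induction l with
  | nil => exact Nat.zero_le _
  | cons x l ih =>
    rw [List.forall_mem_cons] at hl
    rw [List.prod_cons]
    exact (ih hl.2).trans_lt (hν.lt_mul_left hl.1 l.prod)

theorem isAtomicMonoid : IsAtomicMonoid M where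
  generated := hν.closure_atoms_eq_top
  norm_finite x := ⟨ν x, fun _ hl hx => hx ▸ hν.length_le_prod fun a ha => (hl a ha).1⟩

theorem exists_leftGcd [IsLcmMonoid M] (x y : M) : ∃ z, IsLeftGcd x y z := by
  have hbounded : BddAbove (ν '' {d | LeftDvd d x ∧ LeftDvd d y}) := by
    refine ⟨ν x, ?_⟩
    rintro _ ⟨d, ⟨⟨z, rfl⟩, -⟩, rfl⟩
    exact hν.le_mul_right d z
  obtain ⟨d, ⟨hdx, hdy⟩, hmax⟩ :=
    Nat.sSup_mem (Set.Nonempty.image ν (s := {d | LeftDvd d x ∧ LeftDvd d y})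
      ⟨1, one_leftDvd x, one_leftDvd y⟩) hbounded
  refine ⟨d, hdx, hdy, fun t htx hty => rightCompl_eq_one_iff.1 ?_⟩
  have hlcm := isRightLcm_rightCompl d t
  by_contra hne
  refine (hν.lt_mul_right hne d).not_ge (hmax ▸ le_csSup hbounded ?_)
  exact ⟨_, ⟨hlcm.2.2 x hdx htx, hlcm.2.2 y hdy hty⟩, rfl⟩

theorem exists_leftLcm (hgcd : ∀ x y : M, ∃ z, IsRightGcd x y z) {x y : M}
    (hmul : ∃ e, RightDvd x e ∧ RightDvd y e) : ∃ z, IsLeftLcm x y z := by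
  obtain ⟨m, ⟨hxm, hym⟩, hmin⟩ :=
    Nat.sInf_mem (Set.Nonempty.image ν (s := {e | RightDvd x e ∧ RightDvd y e}) hmul)
  refine ⟨m, hxm, hym, fun t hxt hyt => ?_⟩
  obtain ⟨g, ⟨a, rfl⟩, hgt, hg⟩ := hgcd m t
  obtain rfl : a = 1 := by
    by_contra hne
    refine (hν.lt_mul_left hne g).not_ge (hmin ▸ Nat.sInf_le ?_)
    exact ⟨g, ⟨hg x hxm hxt, hg y hym hyt⟩, rfl⟩
  rwa [one_mul]

end IsStrictNorm

theorem isStrictNorm_ncard [IsRightCancelMul M] (hcon : ∀ {x y : M}, x * y = 1 → y = 1)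
    (hfin : ∀ x : M, {d | RightDvd d x}.Finite) :
    IsStrictNorm (fun x : M => {d | RightDvd d x}.ncard) where
  lt_mul_left {x} hx y := by
    refine Set.ncard_lt_ncard ⟨?_, fun hsub => hx ?_⟩ (hfin _)
    · rintro d ⟨z, rfl⟩
      exact ⟨x * z, mul_assoc _ _ _⟩
    · obtain ⟨z, hz⟩ := hsub (show RightDvd (x * y) (x * y) from ⟨1, one_mul _⟩)
      exact hcon (x := z) (mul_right_cancel (b := y) (by rw [mul_assoc, hz, one_mul]))
  lt_mul_right {y} hy x := by
    rw [← Set.ncard_image_of_injective _ (mul_left_injective y)]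
    refine Set.ncard_lt_ncard ⟨?_, fun hsub => hy ?_⟩ (hfin _)
    · rintro _ ⟨d, ⟨z, rfl⟩, rfl⟩
      exact ⟨z, (mul_assoc _ _ _).symm⟩
    · obtain ⟨d, -, hd⟩ := hsub (show RightDvd 1 (x * y) from ⟨x * y, mul_one _⟩)
      exact hcon hd

theorem exists_rightGcd [IsLcmMonoid M] [IsRightCancelMul M] {x y : M}
    (hmul : ∃ e, RightDvd x e ∧ RightDvd y e) : ∃ z, IsRightGcd x y z := by
  obtain ⟨e, ⟨x', rfl⟩, y', hy'⟩ := hmul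
  have hlcm := isRightLcm_rightCompl x' y'
  obtain ⟨g, hg⟩ := hlcm.2.2 _ (leftDvd_mul x' x) ⟨y, hy'⟩
  refine ⟨g, ⟨rightCompl x' y', ?_⟩, ⟨rightCompl y' x', ?_⟩, ?_⟩
  · exact mul_left_cancel ((mul_assoc _ _ _).symm.trans hg)
  · apply mul_left_cancel (a := y')
    rw [← mul_assoc, ← mul_rightCompl_comm, hg, hy']
  · rintro t ⟨a, rfl⟩ ⟨b, rfl⟩
    have hab : x' * a = y' * b :=
      mul_right_cancel (b := t) (by rw [mul_assoc, mul_assoc, hy'])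
    obtain ⟨q, hq⟩ := hlcm.2.2 (x' * a) (leftDvd_mul _ _) ⟨b, hab.symm⟩
    refine ⟨q, mul_left_cancel (a := x' * rightCompl x' y') ?_⟩
    rw [← mul_assoc, hq, hg, mul_assoc]

theorem IsStrictNorm.isGaussian [IsLcmMonoid M] [IsRightCancelMul M] {ν : M → ℕ}
    (hν : IsStrictNorm ν) (hmul : ∀ x y : M, ∃ e, RightDvd x e ∧ RightDvd y e) :
    IsGaussian M where
  atomic := hν.isAtomicMonoid
  cancel := {}
  right_lcm x y := ⟨_, isRightLcm_rightCompl x y⟩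
  left_lcm x y := hν.exists_leftLcm (fun x y => exists_rightGcd (hmul x y)) (hmul x y)
  right_gcd x y := exists_rightGcd (hmul x y)
  left_gcd := hν.exists_leftGcd

theorem IsGaussian.isLcmMonoid (h : IsGaussian M) : IsLcmMonoid M where
  mul_left_cancel := h.cancel.mul_left_cancel
  conical hxy :=
    have ⟨_, hν⟩ := h.atomic.exists_isStrictNorm
    hν.eq_one_of_mul_eq_one hxy
  exists_isRightComplement x y := by
    obtain ⟨z, hz⟩ := h.right_lcm x y
    obtain ⟨t, rfl⟩ := hz.1
    exact ⟨t, hz⟩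

end Norm

section Garside

open scoped Pointwise

variable {M : Type*} [Monoid M]

theorem finite_pow {S : Set M} (hS : S.Finite) (n : ℕ) : (S ^ n).Finite := by
  induction n with
  | zero => exact pow_zero S ▸ Set.finite_one
  | succ n ih => exact pow_succ S n ▸ ih.mul hS

theorem mul_pow_eq_pow_mul_perm {S : Set M} {Δ : M} {σ : Equiv.Perm S}
    (hσ : ∀ s : S, (s : M) * Δ = Δ * σ s) (n : ℕ) (s : S) :
    (s : M) * Δ ^ n = Δ ^ n * (σ ^ n) s := by
  induction n generalizing s with
  | zero => simp only [pow_zero, mul_one, one_mul, Equiv.Perm.one_apply]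
  | succ n ih =>
    rw [pow_succ Δ, ← mul_assoc, ih, mul_assoc, hσ, ← mul_assoc, pow_succ' σ,
      Equiv.Perm.mul_apply]

theorem exists_pow_succ_mem_center {S : Set M} [Finite S] (hgen : Submonoid.closure S = ⊤) {Δ : M}
    {σ : Equiv.Perm S} (hσ : ∀ s : S, (s : M) * Δ = Δ * σ s) :
    ∃ n : ℕ, Δ ^ (n + 1) ∈ Submonoid.center M := by
  obtain ⟨n, hn, hσn⟩ := isOfFinOrder_iff_pow_eq_one.1 (isOfFinOrder_of_finite σ)
  refine ⟨n - 1, Submonoid.mem_center_iff.2 fun x => ?_⟩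
  rw [Nat.sub_add_cancel hn]
  change Commute x (Δ ^ n)
  induction x using Submonoid.dense_induction S hgen with
  | mem s hs =>
    have hs' := mul_pow_eq_pow_mul_perm hσ n ⟨s, hs⟩
    rwa [hσn] at hs'
  | one => exact .one_left _
  | mul x y hx hy => exact hx.mul_left hy

theorem exists_mem_center_leftDvd {S : Set M} (hgen : Submonoid.closure S = ⊤)
    (hS : ∀ s ∈ S, ∃ e ∈ Submonoid.center M, LeftDvd s e) (x : M) :
    ∃ e ∈ Submonoid.center M, LeftDvd x e := by
  induction x using Submonoid.dense_induction S hgen with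
  | mem s hs => exact hS s hs
  | one => exact ⟨1, one_mem _, .refl 1⟩
  | mul x y hx hy =>
    obtain ⟨_, hx, x', rfl⟩ := hx
    obtain ⟨_, hy, y', rfl⟩ := hy
    refine ⟨x * x' * (y * y'), mul_mem hx hy, y' * x', ?_⟩
    rw [mul_assoc x x', Submonoid.mem_center_iff.1 hy x']
    simp only [mul_assoc]

theorem RightDvd.mul_left {x y : M} (h : RightDvd x y) (z : M) : RightDvd x (z * y) := by
  obtain ⟨a, rfl⟩ := h
  exact ⟨z * a, mul_assoc _ _ _⟩

section LeftCancel

variable [IsLeftCancelMul M]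

theorem rightDvd_of_leftDvd_of_mem_center {x e : M} (hxe : LeftDvd x e)
    (he : e ∈ Submonoid.center M) : RightDvd x e := by
  obtain ⟨z, rfl⟩ := hxe
  exact ⟨z, mul_left_cancel (a := x) (by rw [Submonoid.mem_center_iff.1 he, mul_assoc])⟩

variable (hcenter : ∀ x : M, ∃ e ∈ Submonoid.center M, LeftDvd x e)
include hcenter

theorem isRightCancelMul_of_leftDvd_center : IsRightCancelMul M where
  mul_right_cancel z x y hxy := by
    obtain ⟨_, he, z', rfl⟩ := hcenter z
    have hcomm := Submonoid.mem_center_iff.1 he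
    refine mul_left_cancel (a := z * z') ?_
    simp only at hxy
    rw [← hcomm, ← hcomm, ← mul_assoc, ← mul_assoc, hxy]

theorem exists_common_leftMultiple (x y : M) : ∃ e, RightDvd x e ∧ RightDvd y e := by
  obtain ⟨d, hd, hx⟩ := hcenter x
  obtain ⟨e, he, hy⟩ := hcenter y
  refine ⟨d * e, ?_, (rightDvd_of_leftDvd_of_mem_center hy he).mul_left d⟩
  rw [Submonoid.mem_center_iff.1 he]
  exact (rightDvd_of_leftDvd_of_mem_center hx hd).mul_left e

end LeftCancel

variable [IsLcmMonoid M]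

/-- `S` behaves like the set of the divisors of a Garside element `Δ`. In an lcm monoid these
conditions, which involve the right complement only, imply that `Δ` is a Garside element with
set of divisors `S`. -/
structure IsSimpleSet (S : Set M) (Δ : M) : Prop where
  finite : S.Finite
  closure_eq_top : Submonoid.closure S = ⊤
  rightCompl_mem : ∀ x ∈ S, ∀ y ∈ S, rightCompl x y ∈ S
  mem : Δ ∈ S
  leftDvd : ∀ s ∈ S, LeftDvd s Δ
  surjOn : Set.SurjOn (rightCompl · Δ) S S

theorem finite_rightDvd_of_rightCompl_mem {S : Set M} (hfin : S.Finite)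
    (hgen : Submonoid.closure S = ⊤) (hS : ∀ x ∈ S, ∀ y ∈ S, rightCompl x y ∈ S) (x : M) :
    {d | RightDvd d x}.Finite := by
  obtain ⟨n, hn⟩ := exists_mem_pow_of_closure_eq_top hgen x
  refine (finite_pow hfin n).subset ?_
  rintro d ⟨z, rfl⟩
  simpa only [rightCompl_mul] using isComplementOp_rightCompl.compl_mem_pow hS hgen z hn

namespace IsSimpleSet

variable {S : Set M} {Δ : M} (h : IsSimpleSet S Δ)
include h

theorem bijOn : Set.BijOn (rightCompl · Δ) S S :=
  (h.finite.surjOn_iff_bijOn_of_mapsTo fun s hs => h.rightCompl_mem s hs Δ h.mem).1 h.surjOn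

/-- From `s (s \ Δ) = Δ` one gets `s Δ = Δ s''`, where `s''` is the image of `s` under the square
of the permutation `s ↦ s \ Δ`. -/
theorem exists_perm : ∃ σ : Equiv.Perm S, ∀ s : S, (s : M) * Δ = Δ * σ s := by
  let e : Equiv.Perm S := h.bijOn.equiv
  have he (s : S) : (s : M) * e s = Δ := mul_rightCompl_of_leftDvd (h.leftDvd s s.2)
  refine ⟨e ^ 2, fun s => ?_⟩
  rw [pow_two, Equiv.Perm.mul_apply]
  calc (s : M) * Δ = s * (e s * e (e s)) := by rw [he (e s)]
    _ = Δ * e (e s) := by rw [← mul_assoc, he s]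

theorem exists_mem_center_leftDvd (x : M) : ∃ e ∈ Submonoid.center M, LeftDvd x e := by
  have : Finite S := h.finite
  obtain ⟨σ, hσ⟩ := h.exists_perm
  obtain ⟨n, hn⟩ := exists_pow_succ_mem_center h.closure_eq_top hσ
  refine GarsideReversing.exists_mem_center_leftDvd h.closure_eq_top (fun s hs => ⟨_, hn, ?_⟩) x
  exact (h.leftDvd s hs).trans (pow_succ' Δ n ▸ leftDvd_mul _ _)

theorem isRightCancelMul : IsRightCancelMul M :=
  isRightCancelMul_of_leftDvd_center h.exists_mem_center_leftDvd

theorem rightDvd_iff {x : M} : RightDvd x Δ ↔ x ∈ S := by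
  constructor
  · rintro ⟨z, hz⟩
    have hmem := isComplementOp_rightCompl.compl_mem h.rightCompl_mem h.closure_eq_top z h.mem
    rwa [← hz, rightCompl_mul] at hmem
  · intro hx
    obtain ⟨y, hy, rfl⟩ := h.surjOn hx
    exact ⟨y, mul_rightCompl_of_leftDvd (h.leftDvd y hy)⟩

theorem leftDvd_iff {x : M} : LeftDvd x Δ ↔ x ∈ S := by
  refine ⟨?_, h.leftDvd x⟩
  rintro ⟨z, hz⟩
  obtain ⟨y, hy, rfl⟩ := h.surjOn (h.rightDvd_iff.1 ⟨x, hz⟩)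
  have := h.isRightCancelMul
  rwa [mul_right_cancel (hz.trans (mul_rightCompl_of_leftDvd (h.leftDvd y hy)).symm)]

theorem isGarsideElement : IsGarsideElement Δ := by
  have hleft : {x | LeftDvd x Δ} = S := Set.ext fun _ => h.leftDvd_iff
  have hright : {x | RightDvd x Δ} = S := Set.ext fun _ => h.rightDvd_iff
  exact ⟨hleft.trans hright.symm, hleft ▸ h.finite, hleft ▸ h.closure_eq_top⟩

theorem isGarside : IsGarside M where
  gaussian :=
    have := h.isRightCancelMul
    (isStrictNorm_ncard IsLcmMonoid.conical (finite_rightDvd_of_rightCompl_mem h.finite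
      h.closure_eq_top h.rightCompl_mem)).isGaussian
      (exists_common_leftMultiple h.exists_mem_center_leftDvd)
  exists_garside := ⟨Δ, h.isGarsideElement⟩

end IsSimpleSet

end Garside

section Total

variable {A : Type u} {f : A → A → Option (FreeMonoid A)}

/-- The operation `u \_f v` on words, with the junk value `1` where it is undefined. -/
noncomputable def wordCompl (f : A → A → Option (FreeMonoid A)) (u v : FreeMonoid A) :
    FreeMonoid A := (under f u v).getD 1

theorem RevTo.wordCompl_eq {u v w w' : FreeMonoid A} (h : RevTo f u v w w') :
    wordCompl f u v = w := by
  rw [wordCompl, under_eq_some.2 ⟨w', h⟩, Option.getD_some]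

variable (htot : DefinedOn (under f) Set.univ)
include htot

theorem under_eq_wordCompl (u v : FreeMonoid A) : under f u v = some (wordCompl f u v) := by
  obtain ⟨w, hw⟩ := htot u trivial v trivial
  rw [wordCompl, hw, Option.getD_some]

theorem revTo_wordCompl (u v : FreeMonoid A) :
    RevTo f u v (wordCompl f u v) (wordCompl f v u) := by
  obtain ⟨w', h⟩ := under_eq_some.1 (under_eq_wordCompl htot u v)
  rwa [h.symm.wordCompl_eq]

theorem isComplementOp_wordCompl (hself : ∀ a, f a a = some 1) :
    IsComplementOp (wordCompl f) where
  one_left v := (RevTo.one_left v).wordCompl_eq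
  one_right v := (RevTo.one_right v).wordCompl_eq
  self v := (RevTo.self hself v).wordCompl_eq
  mul_left _ _ _ := ((revTo_wordCompl htot _ _).mul_left (revTo_wordCompl htot _ _)).wordCompl_eq
  mul_right _ _ _ := ((revTo_wordCompl htot _ _).mul_right (revTo_wordCompl htot _ _)).wordCompl_eq

theorem wordCompl_mem_underClosure {u v : FreeMonoid A} (hu : u ∈ underClosure f)
    (hv : v ∈ underClosure f) : wordCompl f u v ∈ underClosure f :=
  OpClosure.step u v _ hu hv (under_eq_wordCompl htot u v)

theorem cubeOn_iff_cubeAt {X : Set (FreeMonoid A)} :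
    CubeOn f X ↔ ∀ u ∈ X, ∀ v ∈ X, ∀ w ∈ X, CubeAt (wordCompl f) u v w := by
  simp only [CubeOn, CubeAt, ComplEquiv, EquivPP, underBot, under_eq_wordCompl htot,
    Option.bind_some, Option.some.injEq]

theorem join_eq (u v : FreeMonoid A) : join f u v = some (u * wordCompl f u v) := by
  rw [join, under_eq_wordCompl htot, Option.map_some]

theorem definedOn_join (X : Set (FreeMonoid A)) : DefinedOn (join f) X :=
  fun u _ v _ => ⟨_, join_eq htot u v⟩

theorem mul_wordCompl_mem_joinClosure {u v : FreeMonoid A} (hu : u ∈ joinClosure f)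
    (hv : v ∈ joinClosure f) : u * wordCompl f u v ∈ joinClosure f :=
  OpClosure.step u v _ hu hv (join_eq htot u v)

theorem mk_mul_wordCompl_comm (u v : FreeMonoid A) :
    PresentedMonoid.mk (rels f) (u * wordCompl f u v) =
      PresentedMonoid.mk (rels f) (v * wordCompl f v u) := by
  rw [map_mul, map_mul]
  exact (revTo_wordCompl htot u v).map_mul_eq fun _ _ => PresentedMonoid.mk_eq_mk_of_rel

theorem ComplEquiv.mk_eq_mk {u v : FreeMonoid A} (h : ComplEquiv (wordCompl f) u v) :
    PresentedMonoid.mk (rels f) u = PresentedMonoid.mk (rels f) v := by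
  simpa only [h.1, h.2, mul_one] using mk_mul_wordCompl_comm htot u v

end Total

section Model

variable {A : Type u} {f : A → A → Option (FreeMonoid A)} {M : Type v} [Monoid M]

theorem closure_underClosure : Submonoid.closure (underClosure f) = ⊤ := by
  rw [← top_le_iff, ← FreeMonoid.closure_range_of]
  exact Submonoid.closure_mono fun x hx => .base x hx

theorem closure_joinClosure : Submonoid.closure (joinClosure f) = ⊤ := by
  rw [← top_le_iff, ← closure_underClosure (f := f)]
  exact Submonoid.closure_mono fun x hx => .base x hx

theorem closure_image_eq_top {N : Type*} [Monoid N] {π : N →* M} (hπ : Function.Surjective π)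
    {X : Set N} (hX : Submonoid.closure X = ⊤) : Submonoid.closure (π '' X) = ⊤ := by
  rw [← MonoidHom.map_mclosure, hX, ← MonoidHom.mrange_eq_map, MonoidHom.mrange_eq_top.2 hπ]

variable [IsLcmMonoid M]

/-- A monoid in which reversing computes right lcm's: the homomorphism `π` evaluating words takes
`\_f` to the right complement, and only the empty word to `1`. -/
structure IsReversingModel (f : A → A → Option (FreeMonoid A)) (π : FreeMonoid A →* M) : Prop where
  surjective : Function.Surjective π
  eq_one : ∀ {w}, π w = 1 → w = 1
  under_eq : ∀ u v, ∃ w, under f u v = some w ∧ π w = rightCompl (π u) (π v)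

namespace IsReversingModel

variable {π : FreeMonoid A →* M} (hm : IsReversingModel f π)
include hm

theorem definedOn_under : DefinedOn (under f) Set.univ := fun u _ v _ =>
  (hm.under_eq u v).imp fun _ => And.left

theorem map_wordCompl (u v : FreeMonoid A) :
    π (wordCompl f u v) = rightCompl (π u) (π v) := by
  obtain ⟨w, hw, hπ⟩ := hm.under_eq u v
  rw [wordCompl, hw, Option.getD_some, hπ]

theorem isRightLcm_map_mul_wordCompl (u v : FreeMonoid A) :
    IsRightLcm (π u) (π v) (π (u * wordCompl f u v)) := by
  rw [map_mul, hm.map_wordCompl]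
  exact isRightLcm_rightCompl _ _

theorem under_eq_one_iff {u v : FreeMonoid A} : under f u v = some 1 ↔ LeftDvd (π v) (π u) := by
  rw [under_eq_wordCompl hm.definedOn_under, Option.some.injEq, ← rightCompl_eq_one_iff,
    ← hm.map_wordCompl]
  exact ⟨fun h => by rw [h, map_one], hm.eq_one⟩

theorem equivPP_iff {u v : FreeMonoid A} : EquivPP f (some u) (some v) ↔ π u = π v := by
  rw [EquivPP, hm.under_eq_one_iff, hm.under_eq_one_iff]
  exact ⟨fun h => h.2.antisymm h.1, fun h => h ▸ ⟨.refl _, .refl _⟩⟩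

theorem equivPP_under_iff {u v w : FreeMonoid A} :
    EquivPP f (under f u v) (some w) ↔ rightCompl (π u) (π v) = π w := by
  rw [under_eq_wordCompl hm.definedOn_under, hm.equivPP_iff, hm.map_wordCompl]

theorem exists_apply_eq_some (a b : A) : ∃ w, f a b = some w ∧
    π w = rightCompl (π (FreeMonoid.of a)) (π (FreeMonoid.of b)) := by
  obtain ⟨w, hw, hπ⟩ := hm.under_eq (FreeMonoid.of a) (FreeMonoid.of b)
  obtain ⟨w', hrev⟩ := under_eq_some.1 hw
  exact ⟨w, hrev.eq_some_of_of.1, hπ⟩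

theorem isReversingFunction : IsReversingFunction f where
  self a := by
    obtain ⟨w, hw, hπ⟩ := hm.exists_apply_eq_some a a
    rw [isComplementOp_rightCompl.self] at hπ
    rw [hw, hm.eq_one hπ]
  symm a b _ := (hm.exists_apply_eq_some b a).imp fun _ => And.left

theorem isLcmSelector : IsLcmSelector (fun a => π (FreeMonoid.of a)) f where
  generates := by
    have himage := closure_image_eq_top hm.surjective FreeMonoid.closure_range_of
    rwa [← Set.range_comp] at himage
  defined_iff a b :=
    iff_of_true ((hm.exists_apply_eq_some a b).imp fun _ => And.left) ⟨_, isRightLcm_rightCompl _ _⟩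
  complement a b w hw := by
    obtain ⟨w', hw', hπ⟩ := hm.exists_apply_eq_some a b
    obtain rfl : w = w' := Option.some_injective _ (hw.symm.trans hw')
    have hlift : FreeMonoid.lift (fun a => π (FreeMonoid.of a)) = π := FreeMonoid.lift_restrict π
    rw [hlift, IsRightComplement, hπ]
    exact isRightLcm_rightCompl _ _

theorem cubeOn (X : Set (FreeMonoid A)) : CubeOn f X := by
  intro u _ v _ w _
  simp only [under_eq_wordCompl hm.definedOn_under, underBot, Option.bind_some]
  rw [hm.equivPP_iff]
  simp only [hm.map_wordCompl, ← rightCompl_mul_left, mul_rightCompl_comm]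

theorem map_eq_of_rels {u v : FreeMonoid A} (h : rels f u v) : π u = π v := by
  obtain ⟨a, b, w, w', hw, hw', rfl, rfl⟩ := h
  obtain ⟨z, hz, hπ⟩ := hm.exists_apply_eq_some a b
  obtain ⟨z', hz', hπ'⟩ := hm.exists_apply_eq_some b a
  obtain rfl : w = z := Option.some_injective _ (hw.symm.trans hz)
  obtain rfl : w' = z' := Option.some_injective _ (hw'.symm.trans hz')
  rw [map_mul, map_mul, hπ, hπ', mul_rightCompl_comm]

theorem mk_eq_mk_iff {u v : FreeMonoid A} :
    PresentedMonoid.mk (rels f) u = PresentedMonoid.mk (rels f) v ↔ π u = π v := by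
  constructor
  · intro h
    have hle : conGen (rels f) ≤ Con.ker π := Con.conGen_le.2 fun _ _ => hm.map_eq_of_rels
    exact hle (PresentedMonoid.mk_eq_mk_iff.1 h)
  · intro h
    obtain ⟨huv, hvu⟩ := hm.equivPP_iff.2 h
    rw [under_eq_wordCompl hm.definedOn_under, Option.some.injEq] at huv hvu
    exact ComplEquiv.mk_eq_mk hm.definedOn_under ⟨huv, hvu⟩

theorem exists_mulEquiv : ∃ e : PresentedMonoid (rels f) ≃* M,
    ∀ a, e (PresentedMonoid.of (rels f) a) = π (FreeMonoid.of a) := by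
  have hker : conGen (rels f) = Con.ker π := Con.ext fun _ _ =>
    PresentedMonoid.mk_eq_mk_iff.symm.trans hm.mk_eq_mk_iff
  exact ⟨(Con.congr (.refl _) hker).trans (Con.quotientKerEquivOfSurjective π hm.surjective),
    fun _ => rfl⟩

theorem rightCompl_mem_image_underClosure (x : M) {y : M} (hy : y ∈ π '' underClosure f) :
    rightCompl x y ∈ π '' underClosure f := by
  refine isComplementOp_rightCompl.compl_mem ?_
    (closure_image_eq_top hm.surjective closure_underClosure) x hy
  rintro _ ⟨u, hu, rfl⟩ _ ⟨v, hv, rfl⟩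
  exact ⟨_, wordCompl_mem_underClosure hm.definedOn_under hu hv, hm.map_wordCompl u v⟩

theorem rightCompl_mem_image_joinClosure (x : M) {y : M} (hy : y ∈ π '' joinClosure f) :
    rightCompl x y ∈ π '' joinClosure f := by
  obtain ⟨u, hu, rfl⟩ := hy
  induction hu with
  | base u hu =>
    obtain ⟨v, hv, hvu⟩ := hm.rightCompl_mem_image_underClosure x ⟨u, hu, rfl⟩
    exact ⟨v, .base v hv, hvu⟩
  | step u v w _ _ hw ihu ihv =>
    rw [join_eq hm.definedOn_under, Option.some.injEq] at hw
    subst hw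
    obtain ⟨p, hp, hpu⟩ := ihu
    obtain ⟨q, hq, hqv⟩ := ihv
    have hlcm := (hm.isRightLcm_map_mul_wordCompl u v).rightCompl x
    rw [← hpu, ← hqv] at hlcm
    exact ⟨_, mul_wordCompl_mem_joinClosure hm.definedOn_under hp hq,
      (hm.isRightLcm_map_mul_wordCompl p q).unique hlcm⟩

/-- An element of the join closure is the right lcm of its left divisors in `π '' underClosure f`,
so it is determined by them. -/
theorem leftDvd_of_forall_underClosure {u : FreeMonoid A} (hu : u ∈ joinClosure f) {t : M}
    (ht : ∀ x ∈ π '' underClosure f, LeftDvd x (π u) → LeftDvd x t) : LeftDvd (π u) t := by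
  induction hu with
  | base u hu => exact ht _ ⟨u, hu, rfl⟩ (.refl _)
  | step u v w _ _ hw ihu ihv =>
    rw [join_eq hm.definedOn_under, Option.some.injEq] at hw
    subst hw
    have hlcm := hm.isRightLcm_map_mul_wordCompl u v
    exact hlcm.2.2 t (ihu fun x hx hxu => ht x hx (hxu.trans hlcm.1))
      (ihv fun x hx hxv => ht x hx (hxv.trans hlcm.2.1))

theorem finite_image_joinClosure (hfin : (underClosure f).Finite) :
    (π '' joinClosure f).Finite := by
  let divisors (s : M) : Set M := {x ∈ π '' underClosure f | LeftDvd x s}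
  refine Set.Finite.of_finite_image (f := divisors) ((hfin.image π).powerset.subset ?_) ?_
  · rintro _ ⟨s, -, rfl⟩
    exact Set.sep_subset _ _
  · rintro _ ⟨u, hu, rfl⟩ _ ⟨v, hv, rfl⟩ (huv : divisors (π u) = divisors (π v))
    exact (hm.leftDvd_of_forall_underClosure hu fun x hx hxu => (huv.subset ⟨hx, hxu⟩).2).antisymm
      (hm.leftDvd_of_forall_underClosure hv fun x hx hxv => (huv.superset ⟨hx, hxv⟩).2)

end IsReversingModel

/-- The words obtained from the empty word by appending elements of `X` one at a time without
leaving `J`. -/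
inductive BuiltFrom (X J : Set (FreeMonoid A)) : FreeMonoid A → Prop
  | one : BuiltFrom X J 1
  | mul (v x : FreeMonoid A) (hv : BuiltFrom X J v) (hx : x ∈ X) (hvx : v * x ∈ J) :
      BuiltFrom X J (v * x)

namespace IsReversingModel

variable {π : FreeMonoid A →* M} (hm : IsReversingModel f π)
include hm

theorem builtFrom_mul_wordCompl {u v : FreeMonoid A} (hu : u ∈ joinClosure f)
    (hbu : BuiltFrom (underClosure f) (joinClosure f) u)
    (hbv : BuiltFrom (underClosure f) (joinClosure f) v) :
    BuiltFrom (underClosure f) (joinClosure f) (u * wordCompl f u v) := by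
  have hc := isComplementOp_wordCompl hm.definedOn_under hm.isReversingFunction.self
  induction hbv with
  | one => rwa [hc.one_right, mul_one]
  | mul v x _ hx hvx ih =>
    have hmem := mul_wordCompl_mem_joinClosure hm.definedOn_under hu hvx
    rw [hc.mul_right, ← mul_assoc] at hmem ⊢
    refine .mul _ _ ih (hc.compl_mem ?_ closure_underClosure _ hx) hmem
    exact fun _ hu _ hv => wordCompl_mem_underClosure hm.definedOn_under hu hv

theorem builtFrom_of_mem_joinClosure {w : FreeMonoid A} (hw : w ∈ joinClosure f) :
    BuiltFrom (underClosure f) (joinClosure f) w := by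
  induction hw with
  | base u hu => exact one_mul u ▸ .mul 1 u .one hu ((one_mul u).symm ▸ .base u hu)
  | step u v w hu _ hw ihu ihv =>
    rw [join_eq hm.definedOn_under, Option.some.injEq] at hw
    exact hw ▸ hm.builtFrom_mul_wordCompl hu ihu ihv

open scoped Pointwise

/-- Appending a nonempty word creates a new left divisor in `π '' joinClosure f`. -/
theorem exists_mem_pow_of_builtFrom (hfin : (π '' joinClosure f).Finite) {w : FreeMonoid A}
    (hw : BuiltFrom (underClosure f) (joinClosure f) w) :
    ∃ n ≤ {s ∈ π '' joinClosure f | LeftDvd s (π w)}.ncard, w ∈ underClosure f ^ n := by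
  induction hw with
  | one => exact ⟨0, Nat.zero_le _, Set.mem_one.2 rfl⟩
  | mul v x _ hx hvx ih =>
    rcases eq_or_ne x 1 with rfl | hx1
    · rwa [mul_one]
    obtain ⟨n, hn, hv⟩ := ih
    have hdvd : LeftDvd (π v) (π (v * x)) := map_mul π v x ▸ leftDvd_mul _ _
    have hndvd : ¬ LeftDvd (π (v * x)) (π v) := fun hvx => by
      have heq := hvx.antisymm hdvd
      rw [map_mul, mul_eq_left] at heq
      exact hx1 (hm.eq_one heq)
    have hlt : {s ∈ π '' joinClosure f | LeftDvd s (π v)}.ncard <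
        {s ∈ π '' joinClosure f | LeftDvd s (π (v * x))}.ncard :=
      Set.ncard_lt_ncard ⟨fun s hs => ⟨hs.1, hs.2.trans hdvd⟩,
        fun hsub => hndvd (hsub ⟨⟨_, hvx, rfl⟩, .refl _⟩).2⟩ (hfin.subset (Set.sep_subset _ _))
    exact ⟨n + 1, hn.trans_lt hlt, pow_succ (underClosure f) n ▸ Set.mul_mem_mul hv hx⟩

theorem finite_joinClosure (hfin : (underClosure f).Finite) : (joinClosure f).Finite := by
  have hJ := hm.finite_image_joinClosure hfin
  refine (finite_pow (hfin.insert 1) (π '' joinClosure f).ncard).subset fun w hw => ?_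
  obtain ⟨n, hn, hwn⟩ := hm.exists_mem_pow_of_builtFrom hJ (hm.builtFrom_of_mem_joinClosure hw)
  exact Set.pow_subset_pow (Set.subset_insert _ _) (Set.mem_insert _ _)
    (hn.trans (Set.ncard_le_ncard (Set.sep_subset _ _) hJ)) hwn

theorem omegaCondition_iff (hfin : (underClosure f).Finite) :
    OmegaCondition f ↔ ∃ Δ, IsSimpleSet (π '' joinClosure f) Δ := by
  simp only [OmegaCondition, hm.under_eq_one_iff, hm.equivPP_under_iff]
  constructor
  · rintro ⟨Ω, hΩ, h⟩
    refine ⟨π Ω, hm.finite_image_joinClosure hfin,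
      closure_image_eq_top hm.surjective closure_joinClosure,
      fun x _ _ => hm.rightCompl_mem_image_joinClosure x, ⟨Ω, hΩ, rfl⟩, ?_, ?_⟩
    · rintro _ ⟨u, hu, rfl⟩
      exact (h u hu).1
    · rintro _ ⟨u, hu, rfl⟩
      obtain ⟨v, hv, hvu⟩ := (h u hu).2
      exact ⟨π v, ⟨v, hv, rfl⟩, hvu⟩
  · rintro ⟨_, h⟩
    obtain ⟨Ω, hΩ, rfl⟩ := h.mem
    refine ⟨Ω, hΩ, fun u hu => ⟨h.leftDvd _ ⟨u, hu, rfl⟩, ?_⟩⟩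
    obtain ⟨_, ⟨v, hv, rfl⟩, hvu⟩ := h.surjOn ⟨u, hu, rfl⟩
    exact ⟨v, hv, hvu⟩

theorem exists_forall_leftDvd [Nonempty A] (hfin : (π '' joinClosure f).Finite) :
    ∃ Δ ∈ π '' joinClosure f, ∀ s ∈ π '' joinClosure f, LeftDvd s Δ := by
  obtain ⟨a⟩ := ‹Nonempty A›
  have : Finite (π '' joinClosure f) := hfin
  have : Nonempty (π '' joinClosure f) := ⟨_, _, .base _ (.base _ ⟨a, rfl⟩), rfl⟩
  have : IsTrans M LeftDvd := ⟨fun _ _ _ hrs hst => hrs.trans hst⟩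
  have hdir : Directed LeftDvd (Subtype.val : π '' joinClosure f → M) := by
    rintro ⟨_, u, hu, rfl⟩ ⟨_, v, hv, rfl⟩
    have hlcm := hm.isRightLcm_map_mul_wordCompl u v
    exact ⟨⟨_, _, mul_wordCompl_mem_joinClosure hm.definedOn_under hu hv, rfl⟩, hlcm.1, hlcm.2.1⟩
  obtain ⟨Δ, hΔ⟩ := hdir.finite_le id
  exact ⟨Δ, Δ.2, fun s hs => hΔ ⟨s, hs⟩⟩

theorem exists_isSimpleSet [Nonempty A] [IsRightCancelMul M] (hfin : (underClosure f).Finite) :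
    ∃ Δ, IsSimpleSet (π '' joinClosure f) Δ := by
  have hJ := hm.finite_image_joinClosure hfin
  obtain ⟨Δ, hΔ, hdvd⟩ := hm.exists_forall_leftDvd hJ
  have hmaps : Set.MapsTo (rightCompl · Δ) (π '' joinClosure f) (π '' joinClosure f) :=
    fun s _ => hm.rightCompl_mem_image_joinClosure s hΔ
  have hinj : Set.InjOn (rightCompl · Δ) (π '' joinClosure f) := by
    intro s hs t ht (hst : rightCompl s Δ = rightCompl t Δ)
    apply mul_right_cancel (b := rightCompl s Δ)
    rw [mul_rightCompl_of_leftDvd (hdvd s hs), hst, mul_rightCompl_of_leftDvd (hdvd t ht)]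
  exact ⟨Δ, hJ, closure_image_eq_top hm.surjective closure_joinClosure,
    fun x _ _ => hm.rightCompl_mem_image_joinClosure x, hΔ, hdvd,
    (hJ.injOn_iff_bijOn_of_mapsTo hmaps |>.1 hinj).surjOn⟩

end IsReversingModel

end Model

section Selector

variable {A : Type u} {f : A → A → Option (FreeMonoid A)} {M : Type v} [Monoid M]

/-- Reversing terminates below `z`: whenever `u` and `v` represent left divisors of `z`, the word
`u⁻¹ v` reverses to some `w w'⁻¹`, where `u w` still represents a left divisor of `z`. -/
def RevBelow (f : A → A → Option (FreeMonoid A)) (π : FreeMonoid A →* M) (z : M) : Prop :=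
  ∀ u v, LeftDvd (π u) z → LeftDvd (π v) z →
    ∃ w w', RevTo f u v w w' ∧ LeftDvd (π (u * w)) z

theorem exists_revTo_mul_mul [IsLeftCancelMul M] {π : FreeMonoid A →* M}
    (hπ : ∀ u v, rels f u v → π u = π v) {u₁ v₁ w w' : FreeMonoid A} (h : RevTo f u₁ v₁ w w')
    {t : M} (hleft : RevBelow f π (π w * t)) (hright : RevBelow f π (π w' * t))
    (hcorner : RevBelow f π t) {u₂ v₂ : FreeMonoid A}
    (hu : LeftDvd (π u₂) (π w * t)) (hv : LeftDvd (π v₂) (π w' * t)) :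
    ∃ p q, RevTo f (u₁ * u₂) (v₁ * v₂) p q ∧
      LeftDvd (π (u₁ * u₂ * p)) (π u₁ * (π w * t)) := by
  obtain ⟨p, p', hp, hpt⟩ := hleft u₂ w hu (leftDvd_mul _ _)
  obtain ⟨r, r', hr, hrt⟩ := hright w' v₂ (leftDvd_mul _ _) hv
  have hcomm : π u₂ * π p = π w * π p' := hp.map_mul_eq hπ
  rw [map_mul, hcomm] at hpt
  rw [map_mul] at hrt
  obtain ⟨q, q', hq, hqt⟩ :=
    hcorner p' r (leftDvd_of_mul_leftDvd_mul hpt) (leftDvd_of_mul_leftDvd_mul hrt)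
  refine ⟨p * q, r' * q', h.mul_mul hp hr hq, ?_⟩
  have hprod : π (u₁ * u₂ * (p * q)) = π u₁ * (π w * π (p' * q)) := by
    simp only [map_mul, mul_assoc]
    rw [← mul_assoc (π u₂), hcomm, mul_assoc]
  exact hprod ▸ (hqt.mul_left _).mul_left _

variable {ι : A → M}

theorem finite_preimage_lift [Finite A] {ν : M → ℕ} (hν : IsStrictNorm ν) (hι : ∀ a, ι a ≠ 1)
    {T : Set M} (hT : T.Finite) : (FreeMonoid.lift ι ⁻¹' T).Finite := by
  obtain ⟨N, hN⟩ := (hT.image ν).bddAbove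
  refine ((List.finite_length_le A N).preimage FreeMonoid.toList.injective.injOn).subset ?_
  intro w hw
  have hlen : (w.toList.map ι).length ≤ ν (w.toList.map ι).prod :=
    hν.length_le_prod (List.forall_mem_map.2 fun a _ => hι a)
  rw [List.length_map, ← FreeMonoid.lift_apply] at hlen
  exact hlen.trans (hN ⟨_, hw, rfl⟩)

variable [IsLcmMonoid M]

theorem eq_one_of_lift_eq_one (hι : ∀ a, ι a ≠ 1) {w : FreeMonoid A}
    (hw : FreeMonoid.lift ι w = 1) : w = 1 := by
  cases w using FreeMonoid.casesOn with
  | one => rfl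
  | of_mul a w =>
    rw [map_mul, FreeMonoid.lift_eval_of] at hw
    exact absurd (IsLcmMonoid.conical (mul_eq_one_symm hw)) (hι a)

theorem IsGarsideElement.rightCompl_leftDvd {Δ : M} (hΔ : IsGarsideElement Δ) {x y : M}
    (hx : LeftDvd x Δ) (hy : LeftDvd y Δ) : LeftDvd (rightCompl x y) Δ := by
  obtain ⟨z, hz⟩ := (isRightLcm_rightCompl x y).2.2 Δ hx hy
  have hright : rightCompl x y * z ∈ {t | RightDvd t Δ} := ⟨x, by rw [← mul_assoc, hz]⟩
  rw [← hΔ.divisors_eq] at hright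
  exact (leftDvd_mul _ _).trans hright

namespace IsLcmSelector

variable (hs : IsLcmSelector ι f)
include hs

theorem lift_eq_of_rels (u v : FreeMonoid A) (h : rels f u v) :
    FreeMonoid.lift ι u = FreeMonoid.lift ι v := by
  obtain ⟨a, b, w, w', hw, hw', rfl, rfl⟩ := h
  rw [map_mul, map_mul, FreeMonoid.lift_eval_of, FreeMonoid.lift_eval_of]
  exact (hs.complement a b w hw).unique (hs.complement b a w' hw').symm

theorem exists_apply_eq_some (a b : A) : ∃ w, f a b = some w :=
  (hs.defined_iff a b).2 ⟨_, isRightLcm_rightCompl _ _⟩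

theorem revBelow {ν : M → ℕ} (hν : IsStrictNorm ν) (hι : ∀ a, ι a ≠ 1) (z : M) :
    RevBelow f (FreeMonoid.lift ι) z := by
  induction hn : ν z using Nat.strong_induction_on generalizing z with
  | _ n ih =>
    subst hn
    intro u v hu hv
    cases u using FreeMonoid.casesOn with
    | one => exact ⟨v, 1, .one_left v, by rwa [one_mul]⟩
    | of_mul a u =>
    cases v using FreeMonoid.casesOn with
    | one => exact ⟨1, _, .one_right _, by rwa [mul_one]⟩
    | of_mul b v =>
    obtain ⟨w, hw⟩ := hs.exists_apply_eq_some a b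
    obtain ⟨w', hw'⟩ := hs.exists_apply_eq_some b a
    have hlcm : IsRightLcm (ι a) (ι b) (ι a * FreeMonoid.lift ι w) := hs.complement a b w hw
    have hcomm : ι a * FreeMonoid.lift ι w = ι b * FreeMonoid.lift ι w' :=
      hlcm.unique (hs.complement b a w' hw').symm
    rw [map_mul, FreeMonoid.lift_eval_of] at hu hv
    obtain ⟨t, rfl⟩ := hlcm.2.2 z ((leftDvd_mul _ _).trans hu) ((leftDvd_mul _ _).trans hv)
    have hza := mul_assoc (ι a) (FreeMonoid.lift ι w) t
    have hzb : ι a * FreeMonoid.lift ι w * t = ι b * (FreeMonoid.lift ι w' * t) := by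
      rw [hcomm, mul_assoc]
    have hne : ι a * FreeMonoid.lift ι w ≠ 1 :=
      fun h => hι a (IsLcmMonoid.conical (mul_eq_one_symm h))
    have hleft := ih _ (hza ▸ hν.lt_mul_left (hι a) _) _ rfl
    have hright := ih _ (hzb ▸ hν.lt_mul_left (hι b) _) _ rfl
    have hcorner := ih _ (hν.lt_mul_left hne t) t rfl
    rw [hza] at hu ⊢
    rw [hzb] at hv
    exact exists_revTo_mul_mul hs.lift_eq_of_rels (.of_of hw hw') hleft hright hcorner
      (leftDvd_of_mul_leftDvd_mul hu) (leftDvd_of_mul_leftDvd_mul hv)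

theorem isReversingModel {ν : M → ℕ} (hν : IsStrictNorm ν) (hι : ∀ a, ι a ≠ 1) :
    IsReversingModel f (FreeMonoid.lift ι) where
  surjective := by
    rw [← MonoidHom.mrange_eq_top, FreeMonoid.mrange_lift]
    exact hs.generates
  eq_one := eq_one_of_lift_eq_one hι
  under_eq u v := by
    have hlcm := isRightLcm_rightCompl (FreeMonoid.lift ι u) (FreeMonoid.lift ι v)
    obtain ⟨w, w', hw, hdvd⟩ := hs.revBelow hν hι _ u v hlcm.1 hlcm.2.1
    have hcomm := hw.map_mul_eq hs.lift_eq_of_rels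
    refine ⟨w, under_eq_some.2 ⟨w', hw⟩, mul_left_cancel (a := FreeMonoid.lift ι u) ?_⟩
    rw [map_mul] at hdvd
    exact hdvd.antisymm (hlcm.2.2 _ (leftDvd_mul _ _) (hcomm ▸ leftDvd_mul _ _))

open scoped Pointwise

/-- The complement in `M` preserves the length of decompositions into divisors of `Δ`, so the
elements represented in the closure of the alphabet have bounded length. -/
theorem finite_underClosure [Finite A] {ν : M → ℕ} (hν : IsStrictNorm ν) (hι : ∀ a, ι a ≠ 1)
    {Δ : M} (hΔ : IsGarsideElement Δ) : (underClosure f).Finite := by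
  have hm := hs.isReversingModel hν hι
  choose n hn using fun a => exists_mem_pow_of_closure_eq_top hΔ.generate (ι a)
  obtain ⟨N, hN⟩ := (Set.finite_range n).bddAbove
  refine (finite_preimage_lift hν hι (finite_pow hΔ.finite N)).subset fun w hw => ?_
  change FreeMonoid.lift ι w ∈ {x : M | LeftDvd x Δ} ^ N
  induction hw with
  | base u hu =>
    obtain ⟨a, rfl⟩ := hu
    rw [FreeMonoid.lift_eval_of]
    exact Set.pow_subset_pow_right (one_leftDvd Δ) (hN ⟨a, rfl⟩) (hn a)
  | step u v w _ _ hw _ ihv =>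
    rw [under_eq_wordCompl hm.definedOn_under, Option.some.injEq] at hw
    rw [← hw, hm.map_wordCompl]
    exact isComplementOp_rightCompl.compl_mem_pow (X := {x : M | LeftDvd x Δ})
      (fun x hx y hy => hΔ.rightCompl_leftDvd hx hy) hΔ.generate _ ihv

end IsLcmSelector

theorem IsReversingModel.starStar [Nonempty A] [IsRightCancelMul M] {π : FreeMonoid A →* M}
    (hm : IsReversingModel f π) (hfin : (underClosure f).Finite) : StarStar f where
  finite_closure := ⟨fun u _ v _ => hm.definedOn_under u trivial v trivial, hfin⟩
  cube := hm.cubeOn _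
  omega := (hm.omegaCondition_iff hfin).2 (hm.exists_isSimpleSet hfin)

end Selector

section Presented

variable {A : Type u} {f : A → A → Option (FreeMonoid A)}

section Termination

variable (hdef : DefinedOn (under f) (underClosure f))
include hdef

theorem exists_revTo_mem_underClosure (u : FreeMonoid A) {x : FreeMonoid A}
    (hx : x ∈ underClosure f) : ∃ w ∈ underClosure f, ∃ w', RevTo f u x w w' := by
  induction u using Submonoid.dense_induction (underClosure f) closure_underClosure
    generalizing x with
  | mem u hu =>
    obtain ⟨w, hw⟩ := hdef u hu x hx
    exact ⟨w, OpClosure.step u x w hu hx hw, under_eq_some.1 hw⟩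
  | one => exact ⟨x, hx, 1, .one_left x⟩
  | mul u v hu hv =>
    obtain ⟨w, hw, w', hrev⟩ := hu hx
    obtain ⟨z, hz, z', hrev'⟩ := hv hw
    exact ⟨z, hz, _, hrev.mul_left hrev'⟩

theorem definedOn_under_univ : DefinedOn (under f) Set.univ := by
  intro u _ v _
  simp only [under_eq_some]
  induction v using Submonoid.dense_induction (underClosure f) closure_underClosure
    generalizing u with
  | mem v hv =>
    obtain ⟨w, -, w', hrev⟩ := exists_revTo_mem_underClosure hdef u hv
    exact ⟨w, w', hrev⟩
  | one => exact ⟨1, u, .one_right u⟩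
  | mul v v' hv hv' =>
    obtain ⟨w, w', hrev⟩ := hv u trivial trivial
    obtain ⟨z, z', hrev'⟩ := hv' w' trivial trivial
    exact ⟨_, _, hrev.mul_right hrev'⟩

end Termination

section Congruence

theorem mk_leftDvd_of_wordCompl_eq_one (htot : DefinedOn (under f) Set.univ)
    {u t : FreeMonoid A} (h : wordCompl f t u = 1) :
    LeftDvd (PresentedMonoid.mk (rels f) u) (PresentedMonoid.mk (rels f) t) := by
  have hcomm := mk_mul_wordCompl_comm htot t u
  rw [h, mul_one, map_mul] at hcomm
  exact ⟨_, hcomm.symm⟩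

variable (hc : IsComplementOp (wordCompl f)) (hcube : ∀ u v w, CubeAt (wordCompl f) u v w)

/-- When the cube property holds for all words, the relation `≡⁺⁺` is a congruence. It is then the
one defining the presented monoid. -/
def complCon : Con (FreeMonoid A) where
  r := ComplEquiv (wordCompl f)
  iseqv := ⟨hc.complEquiv_refl, .symm, hc.complEquiv_trans (hcube _ _ _) (hcube _ _ _)⟩
  mul' := hc.complEquiv_mul

include hc hcube

theorem complEquiv_of_mk_eq_mk {u v : FreeMonoid A}
    (h : PresentedMonoid.mk (rels f) u = PresentedMonoid.mk (rels f) v) :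
    ComplEquiv (wordCompl f) u v := by
  have hle : conGen (rels f) ≤ complCon hc hcube := by
    refine Con.conGen_le.2 ?_
    rintro _ _ ⟨a, b, w, w', hw, hw', rfl, rfl⟩
    have hrev : RevTo f (FreeMonoid.of a) (FreeMonoid.of b) w w' := .of_of hw hw'
    have hequiv := hc.mul_complEquiv_mul (FreeMonoid.of a) (FreeMonoid.of b)
    rwa [hrev.wordCompl_eq, hrev.symm.wordCompl_eq] at hequiv
  exact hle (PresentedMonoid.mk_eq_mk_iff.1 h)

theorem eq_one_of_mk_eq_one {w : FreeMonoid A} (h : PresentedMonoid.mk (rels f) w = 1) :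
    w = 1 :=
  hc.eq_one_of_complEquiv_one (complEquiv_of_mk_eq_mk hc hcube h.symm)

theorem wordCompl_eq_one_of_mk_leftDvd {u t : FreeMonoid A}
    (h : LeftDvd (PresentedMonoid.mk (rels f) u) (PresentedMonoid.mk (rels f) t)) :
    wordCompl f t u = 1 := by
  obtain ⟨x, hx⟩ := h
  obtain ⟨x, rfl⟩ := PresentedMonoid.surjective_mk x
  have hequiv := hc.complEquiv_left (hcube _ _ u) (complEquiv_of_mk_eq_mk hc hcube hx)
  rw [hc.mul_left, hc.self, hc.one_right] at hequiv
  exact hc.eq_one_of_complEquiv_one hequiv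

variable (htot : DefinedOn (under f) Set.univ)
include htot

theorem isRightComplement_mk_wordCompl (u v : FreeMonoid A) :
    IsRightComplement (PresentedMonoid.mk (rels f) u) (PresentedMonoid.mk (rels f) v)
      (PresentedMonoid.mk (rels f) (wordCompl f u v)) := by
  rw [IsRightComplement, ← map_mul]
  refine ⟨⟨_, (map_mul _ _ _).symm⟩, ?_, fun t hu hv => ?_⟩
  · rw [mk_mul_wordCompl_comm htot]
    exact ⟨_, (map_mul _ _ _).symm⟩
  · obtain ⟨t, rfl⟩ := PresentedMonoid.surjective_mk t
    have htu := wordCompl_eq_one_of_mk_leftDvd hc hcube hu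
    have htv := wordCompl_eq_one_of_mk_leftDvd hc hcube hv
    refine mk_leftDvd_of_wordCompl_eq_one htot ?_
    rw [hc.mul_right, htu, one_mul]
    exact hc.eq_one_of_cubeAt (hcube t u v) htu htv

theorem isLcmMonoid_presentedMonoid : IsLcmMonoid (PresentedMonoid (rels f)) where
  mul_left_cancel x y z h := by
    obtain ⟨x, rfl⟩ := PresentedMonoid.surjective_mk x
    obtain ⟨y, rfl⟩ := PresentedMonoid.surjective_mk y
    obtain ⟨z, rfl⟩ := PresentedMonoid.surjective_mk z
    have hequiv : ComplEquiv (wordCompl f) (x * y) (x * z) := complEquiv_of_mk_eq_mk hc hcube h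
    rw [ComplEquiv, hc.mul_left_mul, hc.mul_left_mul] at hequiv
    exact ComplEquiv.mk_eq_mk htot hequiv
  conical {x y} h := by
    obtain ⟨x, rfl⟩ := PresentedMonoid.surjective_mk x
    obtain ⟨y, rfl⟩ := PresentedMonoid.surjective_mk y
    rw [← map_mul] at h
    rw [(mul_eq_one'.1 (eq_one_of_mk_eq_one hc hcube h)).2, map_one]
  exists_isRightComplement x y := by
    obtain ⟨u, rfl⟩ := PresentedMonoid.surjective_mk x
    obtain ⟨v, rfl⟩ := PresentedMonoid.surjective_mk y
    exact ⟨_, isRightComplement_mk_wordCompl hc hcube htot u v⟩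

theorem exists_isReversingModel_mk :
    ∃ _ : IsLcmMonoid (PresentedMonoid (rels f)),
      IsReversingModel f (PresentedMonoid.mk (rels f)) := by
  have hlcm := isLcmMonoid_presentedMonoid hc hcube htot
  refine ⟨hlcm, PresentedMonoid.surjective_mk,
    eq_one_of_mk_eq_one hc hcube, fun u v => ⟨_, under_eq_wordCompl htot u v, ?_⟩⟩
  exact (rightCompl_eq (isRightComplement_mk_wordCompl hc hcube htot u v)).symm

end Congruence

theorem exists_isReversingModel_of_cubeOn (hf : IsReversingFunction f)
    (hdef : DefinedOn (under f) (underClosure f)) (hcube : CubeOn f (underClosure f)) :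
    ∃ _ : IsLcmMonoid (PresentedMonoid (rels f)),
      IsReversingModel f (PresentedMonoid.mk (rels f)) := by
  have htot := definedOn_under_univ hdef
  have hc := isComplementOp_wordCompl htot hf.self
  refine exists_isReversingModel_mk hc (hc.cubeAt_of_closure_eq_top ?_ closure_underClosure
    ((cubeOn_iff_cubeAt htot).1 hcube)) htot
  exact fun u hu v hv => wordCompl_mem_underClosure htot hu hv

end Presented

end GarsideReversing

theorem mainTheorem2 {A : Type u} [Nonempty A] (f : A → A → Option (FreeMonoid A)) :
    (∀ (M : Type v) [Monoid M] (ι : A → M), Finite A → (∀ a, ι a ≠ 1) →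
      IsGarside M → IsLcmSelector ι f →
        IsReversingFunction f ∧ StarStar f ∧
          ∃ e : PresentedMonoid (rels f) ≃* M, ∀ a, e (PresentedMonoid.of (rels f) a) = ι a) ∧
    (IsReversingFunction f → StarStar f →
      IsGarside (PresentedMonoid (rels f)) ∧
        IsLcmSelector (PresentedMonoid.of (rels f)) f) ∧
    (IsReversingFunction f → FiniteClosure f → CubeOn f (underClosure f) →
      DefinedOn (join f) (joinClosure f) ∧ (joinClosure f).Finite) := by
  refine ⟨fun M _ ι _ hι hG hs => ?_, fun hf hss => ?_, fun hf hfc hcube => ?_⟩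
  · have := hG.gaussian.isLcmMonoid
    have := hG.gaussian.cancel
    obtain ⟨ν, hν⟩ := hG.gaussian.atomic.exists_isStrictNorm
    obtain ⟨Δ, hΔ⟩ := hG.exists_garside
    have hm := hs.isReversingModel hν hι
    obtain ⟨e, he⟩ := hm.exists_mulEquiv
    exact ⟨hm.isReversingFunction, hm.starStar (hs.finite_underClosure hν hι hΔ), e,
      fun a => (he a).trans (FreeMonoid.lift_eval_of ι a)⟩
  · obtain ⟨_, hm⟩ := exists_isReversingModel_of_cubeOn hf hss.finite_closure.1 hss.cube
    obtain ⟨Δ, hΔ⟩ := (hm.omegaCondition_iff hss.finite_closure.2).1 hss.omega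
    exact ⟨hΔ.isGarside, hm.isLcmSelector⟩
  · obtain ⟨_, hm⟩ := exists_isReversingModel_of_cubeOn hf hfc.1 hcube
    exact ⟨definedOn_join hm.definedOn_under _, hm.finite_joinClosure hfc.2⟩
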